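/- Let $d\ge 1$, and for every prime $p$ let $\alpha_1(p),\dots,\alpha_d(p)$ be complex numbers with $|\alpha_j(p)|\le 1$. Consider the polynomial Euler product of degree $d$ $$F(s)=\prod_p F_p(s),\qquad F_p(s)=\prod_{j=1}^{d}\Bigl(1-\frac{\alpha_j(p)}{p^s}\Bigr)^{-1}\qquad(\Re s>1),$$ and the functions $$\varphi(n,F)=n\prod_{p\mid n}F_p(1)^{-1},\qquad g(m)=\prod_{p\mid m}p\bigl(1-F_p(1)^{-1}\bigr),\qquad C(F)=\frac12\prod_p\Bigl(1-\frac{1-F_p(1)^{-1}}{p}\Bigr).$$ For real $H$ put $$c_F(H)=\sum_{m=1}^{\infty}\frac{\mu^2(m)\,|g(m)|^2}{m^2}\prod_{p\nmid m}\Bigl(1-\frac{2\,\Re\bigl(1-F_p(1)^{-1}\bigr)}{p}\Bigr)\Bigl(\Bigl\{\frac{H}{m}\Bigr\}-\Bigl\{\frac{H}{m}\Bigr\}^2\Bigr),$$ where $\{\cdot\}$ is the fractional part; for real $g$ one has $|g(m)|^2=g(m)^2$ and the real part may be omitted. Then the products and the series above converge unconditionally, and for every $\varepsilon>0$ there is a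 constant $K=K(\varepsilon,F)$ such that, for all real $X\ge 1$ and $H$ with $2\le H\le X^{1-\varepsilon}$, $$\Bigl|\frac1X\int_X^{2X}\Bigl|\sum_{x<n\le x+H}\frac{\varphi(n,F)}{n}-2C(F)H\Bigr|^2dx-c_F(H)\Bigr|\le K\,H^{-\varepsilon}$$ (in particular the integrand is integrable on $[X,2X]$). -/

import Mathlib

/-- A polynomial Euler product of degree `d`,
`F(s) = ∏_p ∏_{j=1}^{d} (1 - α_j(p) p^{-s})⁻¹` for `Re s > 1`, with complex `α_j(p)` such that
`|α_j(p)| ≤ 1` for all primes `p` and all `j`. It is recorded by its local parameters;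
only the values `α j p` at primes `p` are ever used. -/
structure PolynomialEulerProduct (d : ℕ) where
  /-- the local parameters `α_j(p)` -/
  α : Fin d → ℕ → ℂ
  norm_α_le_one : ∀ (j : Fin d) (p : ℕ), p.Prime → ‖α j p‖ ≤ 1

namespace PolynomialEulerProduct

noncomputable section

variable {d : ℕ}

/-- The Euler factor `F_p(s) = ∏_{j=1}^{d} (1 - α_j(p) p^{-s})⁻¹`. -/
def eulerFactor (F : PolynomialEulerProduct d) (p : ℕ) (s : ℂ) : ℂ :=
  ∏ j : Fin d, (1 - F.α j p * (p : ℂ) ^ (-s))⁻¹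

/-- The Euler totient function `φ(n, F) = n ∏_{p ∣ n} F_p(1)⁻¹`. -/
def totient (F : PolynomialEulerProduct d) (n : ℕ) : ℂ :=
  (n : ℂ) * ∏ p ∈ n.primeFactors, (F.eulerFactor p 1)⁻¹

/-- The multiplicative function `g(m) = ∏_{p ∣ m} p (1 - F_p(1)⁻¹)`. -/
def g (F : PolynomialEulerProduct d) (m : ℕ) : ℂ :=
  ∏ p ∈ m.primeFactors, (p : ℂ) * (1 - (F.eulerFactor p 1)⁻¹)

/-- The factor at `p` of the product defining `C(F)`. -/
def meanFactor (F : PolynomialEulerProduct d) (p : Nat.Primes) : ℂ :=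
  1 - (1 - (F.eulerFactor p 1)⁻¹) / ((p : ℕ) : ℂ)

/-- `C(F) = (1/2) ∏_p (1 - (1 - F_p(1)⁻¹) / p)`, the constant for which
`∑_{n ≤ x} φ(n, F) ∼ C(F) x²` when `C(F) ≠ 0`. -/
def C (F : PolynomialEulerProduct d) : ℂ :=
  1 / 2 * ∏' p : Nat.Primes, F.meanFactor p

/-- The factor at `p` of the product over the primes `p ∤ m` that occurs in the `m`-th term of
`c_F(H)`; the primes dividing `m` get the factor `1`. -/
def varianceFactor (F : PolynomialEulerProduct d) (m : ℕ) (p : Nat.Primes) : ℝ :=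
  if (p : ℕ) ∣ m then 1 else 1 - 2 * (1 - (F.eulerFactor p 1)⁻¹).re / ((p : ℕ) : ℝ)

/-- The `m`-th term of the series `c_F(H)`:
`μ²(m) |g(m)|² / m² ∏_{p ∤ m} (1 - 2 Re (1 - F_p(1)⁻¹) / p) ({H/m} - {H/m}²)`. -/
def varianceTerm (F : PolynomialEulerProduct d) (H : ℝ) (m : ℕ) : ℝ :=
  (ArithmeticFunction.moebius m : ℝ) ^ 2 * ‖F.g m‖ ^ 2 / (m : ℝ) ^ 2 *
    (∏' p : Nat.Primes, F.varianceFactor m p) *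
    (Int.fract (H / m) - Int.fract (H / m) ^ 2)

/-- The constant `c_F(H)`, a series over the positive integers. -/
def varianceConstant (F : PolynomialEulerProduct d) (H : ℝ) : ℝ :=
  ∑' m : ℕ+, F.varianceTerm H m

/-- `∑_{x < n ≤ x + H} φ(n, F) / n - 2 C(F) H` (used for `x, H ≥ 0`). -/
def deviation (F : PolynomialEulerProduct d) (H x : ℝ) : ℂ :=
  ∑ n ∈ Finset.Ioc ⌊x⌋₊ ⌊x + H⌋₊, F.totient n / (n : ℂ) - 2 * F.C * (H : ℂ)

/-- The variance over `[X, 2X]`: `(1/X) ∫_X^{2X} |∑_{x < n ≤ x + H} φ(n, F)/n - 2 C(F) H|² dx`. -/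
def variance (F : PolynomialEulerProduct d) (X H : ℝ) : ℝ :=
  1 / X * ∫ x in X..(2 * X), ‖F.deviation H x‖ ^ 2

end

end PolynomialEulerProduct

open Finset Filter Topology MeasureTheory

/-! Write `φ(n,F)/n = ∑_{e ∣ n} a(e)` with `a(e) = μ(e)g(e)/e`. Since `1 - F_p(1)⁻¹ = O(1/p)`, the
function `μg` is bounded at primes, hence is `O(n^η)` for every `η > 0`. Summing over `(x, x+H]`
replaces each `e` by its number of multiples there, which is `H/e` minus the sawtooth difference
`{(x+H)/e} - {x/e}`. The terms `H/e` rebuild `2C(F)H` up to a small tail, so the variance is the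
mean square of a finite sum of sawtooth differences with coefficients `a(e)`.

Squaring out leaves correlations of two sawtooth differences with moduli `m ≤ n`
(`abs_integral_fractDiff_mul_sub_le`). Expanding the one of modulus `n` into its jumps turns the
integral into a sum over multiples `jn` of a function of period `m`, whose Fourier series is
explicit. Frequencies `k` with `m ∣ kn` give the main term `X gcd(m,n)²/(mn) ({H/gcd} - {H/gcd}²)`.
The others give geometric sums of size `1/|sin(πkn/m)|`, which are only logarithmic on average over
`n` (`sum_Icc_sinBound_div_le`). The Fourier weights contribute `H/m`, so the total error is `O(H
X^{5η})` (`abs_integral_norm_sum_sq_sub_le`).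

The main terms extend to an absolutely convergent sum over all pairs. Sorted by greatest common
divisor, it factors into Euler products and equals `c_F(H)` (`hasSum_coeff_mul_fractCorr`). After
division by `X` the error is `O(H X^{5η-1})`, and `5η = ε²` makes this at most `H^{-ε}` in the range
`H ≤ X^{1-ε}`. -/

theorem HasSum.of_eq {ι R : Type*} [AddCommMonoid R] [TopologicalSpace R] {f g : ι → R} {a b : R}
    (h : HasSum f a) (hf : ∀ k, g k = f k) (ha : b = a) : HasSum g b := by
  rw [ha, show g = f from funext hf]
  exact h

/-! ### The function `{t} - {t}²`: antiderivative of the sawtooth and Fourier series -/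

/-- The variance `{t} - {t}²` of the number of integers in a random interval of length `t`. -/
noncomputable def fractVar (t : ℝ) : ℝ := Int.fract t - Int.fract t ^ 2

theorem fractVar_nonneg (t : ℝ) : 0 ≤ fractVar t := by
  have h0 := Int.fract_nonneg t
  have h1 := (Int.fract_lt_one t).le
  unfold fractVar
  nlinarith

theorem fractVar_le_one (t : ℝ) : fractVar t ≤ 1 := by
  have h0 := Int.fract_nonneg t
  have h1 := (Int.fract_lt_one t).le
  unfold fractVar
  nlinarith

theorem fractVar_zero : fractVar 0 = 0 := by simp [fractVar]

theorem continuous_fractVar : Continuous fractVar :=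
  ContinuousOn.comp_fract'' (f := fun t : ℝ => t - t ^ 2) (by fun_prop) (by norm_num)

/-- There are corners at the integers, but a right derivative exists everywhere, and with continuity
this is enough for the fundamental theorem of calculus. -/
theorem hasDerivWithinAt_fractVar (x : ℝ) :
    HasDerivWithinAt fractVar (1 - 2 * Int.fract x) (Set.Ioi x) x := by
  have h : HasDerivWithinAt (fun t : ℝ => (t - ⌊x⌋) - (t - ⌊x⌋) ^ 2) (1 - 2 * Int.fract x)
      (Set.Ioi x) x := by
    have h1 : HasDerivAt (fun t : ℝ => t - ⌊x⌋) 1 x := (hasDerivAt_id x).sub_const _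
    have h2 := h1.sub (h1.pow 2)
    refine (h2.congr_deriv ?_).hasDerivWithinAt
    simp [← Int.self_sub_floor]
  refine h.congr_of_eventuallyEq ?_ ?_
  · have hx : Set.Ioo x (⌊x⌋ + 1) ∈ 𝓝[>] x := Ioo_mem_nhdsGT (Int.lt_floor_add_one x)
    filter_upwards [hx] with t ht
    have : ⌊t⌋ = ⌊x⌋ := by
      rw [Int.floor_eq_iff]
      exact ⟨(Int.floor_le x).trans ht.1.le, ht.2⟩
    simp only [fractVar, ← Int.self_sub_floor, this]
  · simp only [fractVar, ← Int.self_sub_floor]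

theorem intervalIntegrable_fract_div (m c a b : ℝ) :
    IntervalIntegrable (fun x : ℝ => Int.fract ((x + c) / m)) volume a b := by
  refine (intervalIntegrable_const (c := (1 : ℝ))).mono_fun ?_ ?_
  · exact (by fun_prop : Measurable fun x : ℝ => Int.fract ((x + c) / m)).aestronglyMeasurable
  · refine Eventually.of_forall fun x => ?_
    simp only [Real.norm_eq_abs, abs_one]
    rw [abs_of_nonneg (Int.fract_nonneg _)]
    exact (Int.fract_lt_one _).le

theorem integral_fract_div {m : ℝ} (hm : 0 < m) (c a b : ℝ) :
    ∫ x in a..b, Int.fract ((x + c) / m) =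
      (b - a) / 2 - m / 2 * (fractVar ((b + c) / m) - fractVar ((a + c) / m)) := by
  have h := intervalIntegral.integral_eq_sub_of_hasDeriv_right (a := a) (b := b)
    (f := fun x : ℝ => x / 2 - m / 2 * fractVar ((x + c) / m))
    (f' := fun x : ℝ => Int.fract ((x + c) / m)) ?_ ?_ (intervalIntegrable_fract_div m c a b)
  · rw [h]; ring
  · have := continuous_fractVar
    fun_prop
  · intro x _
    have h1 : HasDerivWithinAt (fun x : ℝ => (x + c) / m) (1 / m) (Set.Ioi x) x :=
      (((hasDerivAt_id x).add_const c).div_const m).hasDerivWithinAt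
    have h2 := (hasDerivWithinAt_fractVar ((x + c) / m)).scomp x h1 (fun t ht => by
      simp only [Set.mem_Ioi] at ht ⊢
      gcongr)
    have h3 := (((hasDerivAt_id x).div_const 2).hasDerivWithinAt (s := Set.Ioi x)).sub
      (h2.const_mul (m / 2))
    refine h3.congr_deriv ?_
    simp only [smul_eq_mul]
    field_simp
    ring

/-- The slope `1 - 2{t}` has absolute value at most `1`. -/
theorem abs_fractVar_sub_le (s t : ℝ) : |fractVar s - fractVar t| ≤ |s - t| := by
  have h := integral_fract_div one_pos 0 t s
  simp only [add_zero, div_one] at h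
  have h2 : ∫ x in t..s, (Int.fract x - 1 / 2) = - (1 / 2) * (fractVar s - fractVar t) := by
    rw [intervalIntegral.integral_sub, h, intervalIntegral.integral_const, smul_eq_mul]
    · ring
    · simpa using intervalIntegrable_fract_div 1 0 t s
    · exact intervalIntegrable_const
  have h3 := intervalIntegral.norm_integral_le_of_norm_le_const (a := t) (b := s) (C := 1 / 2)
    (f := fun x => Int.fract x - 1 / 2) (fun x _ => by
      rw [Real.norm_eq_abs, abs_le]
      constructor <;> linarith [Int.fract_nonneg x, Int.fract_lt_one x])
  rw [h2, Real.norm_eq_abs, abs_mul] at h3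
  norm_num at h3
  linarith

theorem fractVar_le_self {t : ℝ} (ht : 0 ≤ t) : fractVar t ≤ t := by
  have := abs_fractVar_sub_le t 0
  rw [fractVar_zero, sub_zero, sub_zero, abs_of_nonneg ht] at this
  exact (le_abs_self _).trans this

/-- This is the Fourier series of the Bernoulli polynomial `x² - x + 1/6`: subtracting its value at
`{t}` from its value at `0` cancels the constant. The term `k = 0` is `0/0 = 0`. -/
theorem hasSum_one_sub_cos_div_sq (t : ℝ) :
    HasSum (fun k : ℕ => (1 - Real.cos (2 * Real.pi * k * t)) / (k : ℝ) ^ 2)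
      (Real.pi ^ 2 * fractVar t) := by
  have key : ∀ x : ℝ, x ∈ Set.Icc (0 : ℝ) 1 →
      HasSum (fun k : ℕ => 1 / (k : ℝ) ^ 2 * Real.cos (2 * Real.pi * k * x))
        (Real.pi ^ 2 * (x ^ 2 - x + 6⁻¹)) := by
    intro x hx
    have h := hasSum_one_div_nat_pow_mul_cos one_ne_zero hx
    have h2 := bernoulliFun_two x
    rw [bernoulliFun] at h2
    simp only [mul_one] at h
    rw [h2] at h
    convert h using 1
    rw [Nat.factorial_two]
    push_cast
    ring
  have h0 := key 0 (by simp)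
  have h1 := key (Int.fract t) ⟨Int.fract_nonneg t, (Int.fract_lt_one t).le⟩
  refine (h0.sub h1).of_eq (fun k => ?_) ?_
  · have : Real.cos (2 * Real.pi * k * Int.fract t) = Real.cos (2 * Real.pi * k * t) := by
      rw [← Int.self_sub_floor, ← Real.cos_sub_int_mul_two_pi (2 * Real.pi * k * t) (k * ⌊t⌋)]
      congr 1
      push_cast
      ring
    rw [this]
    simp
    ring
  · unfold fractVar
    ring

/-! ### Sawtooth differences and their periodic antiderivatives -/

/-- The centred number of multiples of `m` in `(x, x + H]`, with the sign reversed. -/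
noncomputable def fractDiff (m H x : ℝ) : ℝ := Int.fract ((x + H) / m) - Int.fract (x / m)

/-- A periodic antiderivative of `fractDiff m H`. -/
noncomputable def fractDiffPrim (m H x : ℝ) : ℝ :=
  -(m / 2) * (fractVar ((x + H) / m) - fractVar (x / m))

theorem measurable_fractDiff (m H : ℝ) : Measurable (fractDiff m H) := by
  unfold fractDiff
  fun_prop

theorem abs_fractDiff_le_one (m H x : ℝ) : |fractDiff m H x| ≤ 1 := by
  unfold fractDiff
  rw [abs_le]
  constructor <;> linarith [Int.fract_nonneg ((x + H) / m), Int.fract_lt_one ((x + H) / m),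
    Int.fract_nonneg (x / m), Int.fract_lt_one (x / m)]

theorem intervalIntegrable_fractDiff (m H a b : ℝ) :
    IntervalIntegrable (fractDiff m H) volume a b := by
  have h := (intervalIntegrable_fract_div m H a b).sub (intervalIntegrable_fract_div m 0 a b)
  simp only [add_zero] at h
  exact h

theorem integral_fractDiff {m : ℝ} (hm : 0 < m) (H a b : ℝ) :
    ∫ x in a..b, fractDiff m H x = fractDiffPrim m H b - fractDiffPrim m H a := by
  have h := intervalIntegral.integral_sub (intervalIntegrable_fract_div m H a b)
    (intervalIntegrable_fract_div m 0 a b)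
  rw [integral_fract_div hm, integral_fract_div hm] at h
  simp only [add_zero] at h
  unfold fractDiff
  rw [h, fractDiffPrim, fractDiffPrim]
  ring

theorem abs_fractDiffPrim_le_left {m : ℝ} (hm : 0 < m) (H x : ℝ) : |fractDiffPrim m H x| ≤ m := by
  rw [fractDiffPrim, abs_mul, abs_neg, abs_of_pos (half_pos hm)]
  have : |fractVar ((x + H) / m) - fractVar (x / m)| ≤ 1 := by
    rw [abs_le]
    constructor <;> linarith [fractVar_nonneg ((x + H) / m), fractVar_nonneg (x / m),
      fractVar_le_one ((x + H) / m), fractVar_le_one (x / m)]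
  nlinarith

theorem abs_fractDiffPrim_le_right {m H : ℝ} (hm : 0 < m) (hH : 0 ≤ H) (x : ℝ) :
    |fractDiffPrim m H x| ≤ H := by
  rw [fractDiffPrim, abs_mul, abs_neg, abs_of_pos (half_pos hm)]
  have h := abs_fractVar_sub_le ((x + H) / m) (x / m)
  rw [← sub_div, add_sub_cancel_left, abs_of_nonneg (div_nonneg hH hm.le)] at h
  calc m / 2 * |fractVar ((x + H) / m) - fractVar (x / m)| ≤ m / 2 * (H / m) := by gcongr
    _ = H / 2 := by field_simp
    _ ≤ H := by linarith

/-- Fourier coefficients of `{t} - {t}²`, up to normalisation. -/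
noncomputable def cosCoeff (t : ℝ) (k : ℕ) : ℝ := (1 - Real.cos (2 * Real.pi * k * t)) / (k : ℝ) ^ 2

theorem cosCoeff_nonneg (t : ℝ) (k : ℕ) : 0 ≤ cosCoeff t k :=
  div_nonneg (by linarith [Real.cos_le_one (2 * Real.pi * k * t)]) (by positivity)

theorem hasSum_cosCoeff (t : ℝ) : HasSum (cosCoeff t) (Real.pi ^ 2 * fractVar t) :=
  hasSum_one_sub_cos_div_sq t

/-- The left side of the jump formula is a second difference of `fractVar` with step `H/m`, so
`cos(u+v) + cos(u-v) = 2 cos u cos v` separates the dependence on `y` from that on `H`. -/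
theorem hasSum_fractDiffPrim_sub (m H y : ℝ) :
    HasSum (fun k : ℕ => -(m / Real.pi ^ 2) * (cosCoeff (H / m) k *
      Real.cos (2 * Real.pi * k * (y / m))))
      (fractDiffPrim m H y - fractDiffPrim m H (y - H)) := by
  have h := (((hasSum_one_sub_cos_div_sq ((y + H) / m)).add
    (hasSum_one_sub_cos_div_sq ((y - H) / m))).sub
    ((hasSum_one_sub_cos_div_sq (y / m)).mul_left 2)).mul_left (-(m / 2) / Real.pi ^ 2)
  refine h.of_eq (fun k => ?_) ?_
  · have h1 : 2 * Real.pi * k * ((y + H) / m) =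
      2 * Real.pi * k * (y / m) + 2 * Real.pi * k * (H / m) := by ring
    have h2 : 2 * Real.pi * k * ((y - H) / m) =
      2 * Real.pi * k * (y / m) - 2 * Real.pi * k * (H / m) := by ring
    rw [h1, h2, Real.cos_add, Real.cos_sub, cosCoeff]
    ring
  · have := Real.pi_ne_zero
    unfold fractDiffPrim
    rw [sub_add_cancel]
    field_simp
    ring

/-! ### Correlation integrals as sums over the jumps of one factor -/

/-- The lower limit is `t` clamped to `[a, b]`, which covers thresholds outside the interval as
well. -/
theorem integral_ite_le {f : ℝ → ℝ} {a b : ℝ} (hab : a ≤ b) (t : ℝ)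
    (hf : IntervalIntegrable f volume a b) :
    IntervalIntegrable (fun x => if t ≤ x then f x else 0) volume a b ∧
    ∫ x in a..b, (if t ≤ x then f x else 0) = ∫ x in (max a (min t b))..b, f x := by
  set c := max a (min t b) with hc
  have hac : a ≤ c := le_max_left _ _
  have hcb : c ≤ b := max_le hab (min_le_right _ _)
  have hne : ∀ᵐ x : ℝ, x ≠ c := by
    simp [ae_iff, measure_singleton]
  have h1 : ∀ᵐ x : ℝ, x ∈ Set.uIoc a c → (fun _ => (0 : ℝ)) x = if t ≤ x then f x else 0 := by
    filter_upwards [hne] with x hx hxm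
    rw [Set.uIoc_of_le hac] at hxm
    have hlt : x < c := lt_of_le_of_ne hxm.2 hx
    have : x < t := by
      rcases lt_max_iff.mp hlt with h | h
      · linarith [hxm.1]
      · exact h.trans_le (min_le_left _ _)
    rw [if_neg (not_le.mpr this)]
  have h2 : ∀ᵐ x : ℝ, x ∈ Set.uIoc c b → f x = if t ≤ x then f x else 0 := by
    refine Eventually.of_forall fun x hxm => ?_
    rw [Set.uIoc_of_le hcb] at hxm
    have : t ≤ x := by
      rcases le_total t b with h | h
      · rw [min_eq_left h] at hc
        exact (le_max_right a t).trans (hc ▸ hxm.1.le)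
      · rw [min_eq_right h, max_eq_right hab] at hc
        linarith [hxm.1, hxm.2]
    rw [if_pos this]
  have hfc : IntervalIntegrable f volume c b :=
    hf.mono_set (by rw [Set.uIcc_of_le hab, Set.uIcc_of_le hcb]; exact Set.Icc_subset_Icc_left hac)
  have i1 : IntervalIntegrable (fun x => if t ≤ x then f x else 0) volume a c :=
    (intervalIntegrable_const (c := (0 : ℝ))).congr_ae
      ((ae_restrict_iff' measurableSet_uIoc).mpr h1)
  have i2 : IntervalIntegrable (fun x => if t ≤ x then f x else 0) volume c b :=
    hfc.congr_ae ((ae_restrict_iff' measurableSet_uIoc).mpr h2)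
  refine ⟨i1.trans i2, ?_⟩
  rw [← intervalIntegral.integral_add_adjacent_intervals i1 i2,
    ← intervalIntegral.integral_congr_ae h1, ← intervalIntegral.integral_congr_ae h2]
  simp

theorem sum_ite_mul_le {n : ℝ} (hn : 0 < n) {y : ℝ} (hy : 0 ≤ y) {a b : ℕ}
    (ha : a ≤ ⌊y / n⌋₊) (hb : ⌊y / n⌋₊ ≤ b) :
    ∑ j ∈ Ioc a b, (if (j : ℝ) * n ≤ y then (1 : ℝ) else 0) = (⌊y / n⌋₊ : ℝ) - a := by
  rw [← Finset.sum_filter]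
  have : (Ioc a b).filter (fun j : ℕ => (j : ℝ) * n ≤ y) = Ioc a ⌊y / n⌋₊ := by
    ext j
    simp only [mem_filter, mem_Ioc]
    rw [Nat.le_floor_iff (by positivity), le_div_iff₀ hn]
    constructor
    · rintro ⟨⟨h1, h2⟩, h3⟩
      exact ⟨h1, h3⟩
    · rintro ⟨h1, h3⟩
      refine ⟨⟨h1, le_trans ?_ hb⟩, h3⟩
      rw [Nat.le_floor_iff (by positivity), le_div_iff₀ hn]
      exact h3
  rw [this]
  simp [Nat.cast_sub ha]

theorem floor_add_div_sub_le {n H y : ℝ} (hn : 0 < n) (hH : 0 ≤ H) (hy : 0 ≤ y) :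
    (⌊(y + H) / n⌋₊ : ℝ) - ⌊y / n⌋₊ ≤ H / n + 1 := by
  have h1 := Nat.floor_le (a := (y + H) / n) (by positivity)
  have h2 := Nat.lt_floor_add_one (y / n)
  have h3 := add_div y H n
  linarith

/-- The bracket counts the multiples of `n` in `(x, x + H]`. -/
theorem fractDiff_eq {n H x : ℝ} (hn : 0 < n) (hH : 0 ≤ H) (hx : 0 ≤ x) :
    fractDiff n H x = H / n - ((⌊(x + H) / n⌋₊ : ℝ) - ⌊x / n⌋₊) := by
  have h1 : ((⌊(x + H) / n⌋₊ : ℕ) : ℝ) = (⌊(x + H) / n⌋ : ℝ) :=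
    natCast_floor_eq_intCast_floor (by positivity)
  have h2 : ((⌊x / n⌋₊ : ℕ) : ℝ) = (⌊x / n⌋ : ℝ) :=
    natCast_floor_eq_intCast_floor (by positivity)
  rw [fractDiff, h1, h2, ← Int.self_sub_floor, ← Int.self_sub_floor]
  ring

/-- A multiple `jn` is counted exactly for `x ∈ [jn - H, jn)`, so integrating the other factor `f`
over that range gives `P(jn) - P(jn - H)`, with both endpoints clamped to `[X, 2X]`. Only the `j`
with `jn` within `H` after one of the two endpoints are treated wrongly by dropping the clamp and
the range beyond `2X`: at most `H/n + 1` at each end, costing `2B` apiece. -/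
theorem abs_integral_fractDiff_mul_add_sum_le {m n X H B : ℝ} (hm : 0 < m) (hn : 0 < n)
    (hX : 0 ≤ X) (hH : 0 ≤ H) (hB : ∀ x, |fractDiffPrim m H x| ≤ B) :
    |(∫ x in X..(2 * X), fractDiff m H x * fractDiff n H x) -
      H / n * (fractDiffPrim m H (2 * X) - fractDiffPrim m H X) +
      ∑ j ∈ Ioc ⌊X / n⌋₊ ⌊2 * X / n⌋₊,
        (fractDiffPrim m H (j * n) - fractDiffPrim m H (j * n - H))| ≤
      4 * B * (H / n + 1) := by
  set P := fractDiffPrim m H with hP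
  set f := fractDiff m H with hf
  have hB0 : 0 ≤ B := (abs_nonneg _).trans (hB 0)
  have hXX : X ≤ 2 * X := by linarith
  set J := Ioc ⌊X / n⌋₊ ⌊(2 * X + H) / n⌋₊ with hJ
  set cl : ℝ → ℝ := fun t => max X (min t (2 * X)) with hcl
  have hint : ∀ a b, IntervalIntegrable f volume a b := intervalIntegrable_fractDiff m H
  have step1 : ∀ x ∈ Set.uIcc X (2 * X), f x * fractDiff n H x =
      H / n * f x - ∑ j ∈ J, ((if (j : ℝ) * n - H ≤ x then f x else 0) -
        (if (j : ℝ) * n ≤ x then f x else 0)) := by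
    intro x hx
    rw [Set.uIcc_of_le hXX] at hx
    have hx0 : 0 ≤ x := hX.trans hx.1
    have e1 := sum_ite_mul_le hn (y := x) hx0 (a := ⌊X / n⌋₊) (b := ⌊(2 * X + H) / n⌋₊)
      (Nat.floor_mono (by gcongr; exact hx.1)) (Nat.floor_mono (by gcongr; linarith [hx.2]))
    have e2 := sum_ite_mul_le hn (y := x + H) (by positivity) (a := ⌊X / n⌋₊)
      (b := ⌊(2 * X + H) / n⌋₊)
      (Nat.floor_mono (by gcongr; linarith [hx.1])) (Nat.floor_mono (by gcongr; exact hx.2))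
    rw [fractDiff_eq hn hH hx0]
    have e3 : ∑ j ∈ J, ((if (j : ℝ) * n - H ≤ x then f x else 0) -
        (if (j : ℝ) * n ≤ x then f x else 0)) =
        f x * (∑ j ∈ J, (if (j : ℝ) * n ≤ x + H then (1 : ℝ) else 0)) -
        f x * (∑ j ∈ J, (if (j : ℝ) * n ≤ x then (1 : ℝ) else 0)) := by
      rw [Finset.mul_sum, Finset.mul_sum, ← Finset.sum_sub_distrib]
      refine Finset.sum_congr rfl fun j _ => ?_
      simp only [sub_le_iff_le_add, mul_ite, mul_one, mul_zero]
    rw [e3, e1, e2]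
    ring
  have step2 : ∫ x in X..(2 * X), f x * fractDiff n H x =
      H / n * (P (2 * X) - P X) - ∑ j ∈ J, (P (cl (j * n)) - P (cl (j * n - H))) := by
    rw [intervalIntegral.integral_congr step1, intervalIntegral.integral_sub,
      intervalIntegral.integral_const_mul, integral_fractDiff hm,
      intervalIntegral.integral_finsetSum]
    · congr 1
      refine Finset.sum_congr rfl fun j _ => ?_
      rw [intervalIntegral.integral_sub (integral_ite_le hXX _ (hint _ _)).1
        (integral_ite_le hXX _ (hint _ _)).1, (integral_ite_le hXX _ (hint _ _)).2,
        (integral_ite_le hXX _ (hint _ _)).2, integral_fractDiff hm, integral_fractDiff hm]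
      ring
    · exact fun j _ => (integral_ite_le hXX _ (hint _ _)).1.sub
        (integral_ite_le hXX _ (hint _ _)).1
    · exact (hint _ _).const_mul _
    · have h := IntervalIntegrable.sum J (μ := volume) (a := X) (b := 2 * X)
        (f := fun (j : ℕ) x => (if (j : ℝ) * n - H ≤ x then f x else 0) -
        (if (j : ℝ) * n ≤ x then f x else 0)) fun j _ =>
          (integral_ite_le hXX _ (hint _ _)).1.sub (integral_ite_le hXX _ (hint _ _)).1
      refine h.congr ?_
      intro x _
      simp
  have hle1 : ⌊X / n⌋₊ ≤ ⌊2 * X / n⌋₊ := Nat.floor_mono (by gcongr)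
  have hle2 : ⌊2 * X / n⌋₊ ≤ ⌊(2 * X + H) / n⌋₊ := Nat.floor_mono (by gcongr; linarith)
  have split := Finset.sum_Ioc_consecutive (fun j : ℕ => P (cl (j * n)) - P (cl (j * n - H)))
    hle1 hle2
  have hcount : 0 ≤ H / n + 1 := by positivity
  have hPP : ∀ u v, |P u - P v| ≤ 2 * B := fun u v => by
    have h1 := abs_le.mp (hB u)
    have h2 := abs_le.mp (hB v)
    rw [abs_le]
    constructor <;> linarith
  have part2 : |∑ j ∈ Ioc ⌊2 * X / n⌋₊ ⌊(2 * X + H) / n⌋₊, (P (cl (j * n)) - P (cl (j * n - H)))| ≤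
      2 * B * (H / n + 1) := by
    refine (Finset.abs_sum_le_sum_abs _ _).trans ((Finset.sum_le_card_nsmul _ _ (2 * B)
      fun j _ => hPP _ _).trans ?_)
    rw [Nat.card_Ioc, nsmul_eq_mul, mul_comm, Nat.cast_sub hle2]
    gcongr
    exact floor_add_div_sub_le hn hH (by positivity)
  have part1 : |∑ j ∈ Ioc ⌊X / n⌋₊ ⌊2 * X / n⌋₊, ((P (j * n) - P (j * n - H)) -
      (P (cl (j * n)) - P (cl (j * n - H))))| ≤ 2 * B * (H / n + 1) := by
    refine (Finset.abs_sum_le_sum_abs _ _).trans ?_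
    have hb : ∀ j ∈ Ioc ⌊X / n⌋₊ ⌊2 * X / n⌋₊, |(P (j * n) - P (j * n - H)) -
        (P (cl (j * n)) - P (cl (j * n - H)))| ≤
        2 * B * (if (j : ℝ) * n ≤ X + H then 1 else 0) := by
      intro j hj
      rw [mem_Ioc, Nat.floor_lt (by positivity), Nat.le_floor_iff (by positivity),
        div_lt_iff₀ hn, le_div_iff₀ hn] at hj
      have hc1 : cl (j * n) = j * n := by
        simp only [hcl]
        rw [min_eq_left hj.2, max_eq_right hj.1.le]
      rw [hc1]
      split_ifs with h
      · have := hPP (cl (j * n - H)) (j * n - H)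
        rw [mul_one]
        refine le_trans (le_of_eq ?_) this
        congr 1
        ring
      · have hc2 : cl (j * n - H) = j * n - H := by
          simp only [hcl]
          rw [min_eq_left (by linarith [hj.2]), max_eq_right (by linarith [not_le.mp h])]
        rw [hc2]
        simp
    refine (Finset.sum_le_sum hb).trans ?_
    rw [← Finset.mul_sum]
    gcongr
    -- The maximum makes the range long enough to count every multiple up to `X + H`, even when `H >
    -- X`.
    have hsub : Ioc ⌊X / n⌋₊ ⌊2 * X / n⌋₊ ⊆
        Ioc ⌊X / n⌋₊ (max ⌊2 * X / n⌋₊ ⌊(X + H) / n⌋₊) :=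
      Finset.Ioc_subset_Ioc_right (le_max_left _ _)
    refine (Finset.sum_le_sum_of_subset_of_nonneg hsub fun _ _ _ => by positivity).trans ?_
    rw [sum_ite_mul_le hn (by positivity) (Nat.floor_mono (by gcongr; linarith)) (le_max_right _ _)]
    exact floor_add_div_sub_le hn hH hX
  rw [Finset.sum_sub_distrib] at part1
  rw [step2, ← split]
  rw [abs_le] at part1 part2 ⊢
  constructor <;> linarith [part1.1, part1.2, part2.1, part2.2]

/-! ### Cosine sums along progressions and the reciprocal sine -/

theorem two_mul_sin_mul_sum_cos (x : ℝ) {a b : ℕ} (hab : a ≤ b) :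
    2 * Real.sin (Real.pi * x) * ∑ j ∈ Ioc a b, Real.cos (2 * Real.pi * j * x) =
      Real.sin ((2 * b + 1) * (Real.pi * x)) - Real.sin ((2 * a + 1) * (Real.pi * x)) := by
  induction b, hab using Nat.le_induction with
  | base => simp
  | succ b hab ih =>
    rw [← Finset.insert_Ioc_right_eq_Ioc_add_one hab, Finset.sum_insert (by simp), mul_add, ih]
    have h1 : (2 * ((b + 1 : ℕ) : ℝ) + 1) * (Real.pi * x) =
      2 * Real.pi * ((b + 1 : ℕ) : ℝ) * x + Real.pi * x := by ring
    have h2 : (2 * (b : ℝ) + 1) * (Real.pi * x) =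
      2 * Real.pi * ((b + 1 : ℕ) : ℝ) * x - Real.pi * x := by push_cast; ring
    rw [h1, h2, Real.sin_add, Real.sin_sub]
    ring

/-- An upper bound for `1 / |sin (π a / m)|`, set to `0` when `m ∣ a`. -/
noncomputable def sinBound (m a : ℕ) : ℝ :=
  if m ∣ a then 0 else (m : ℝ) / 2 * (1 / (a % m : ℕ) + 1 / ((m : ℝ) - (a % m : ℕ)))

theorem two_mul_div_le_sin {m r : ℝ} (hm : 0 < m) (hr : 0 ≤ r) (hrm : r ≤ m / 2) :
    2 * r / m ≤ Real.sin (Real.pi * (r / m)) := by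
  have h := Real.mul_le_sin (x := Real.pi * (r / m)) (by positivity) (by
    have : r / m ≤ 1 / 2 := by rw [div_le_iff₀ hm]; linarith
    nlinarith [Real.pi_pos])
  convert h using 1
  field_simp

/-- Concavity of the sine bounds it below by the distance to the nearer end of `[0, m]`. Adding the
two reciprocals instead of taking their maximum makes the bound easy to sum over residues. -/
theorem one_div_sin_le {m r : ℝ} (hr : 0 < r) (hrm : r < m) :
    0 < Real.sin (Real.pi * (r / m)) ∧
    1 / Real.sin (Real.pi * (r / m)) ≤ m / 2 * (1 / r + 1 / (m - r)) := by
  have hm : 0 < m := hr.trans hrm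
  have hmr : 0 < m - r := sub_pos.mpr hrm
  rcases le_total r (m / 2) with h | h
  · have h1 := two_mul_div_le_sin hm hr.le h
    have h2 : 0 < 2 * r / m := by positivity
    refine ⟨h2.trans_le h1, (one_div_le_one_div_of_le h2 h1).trans ?_⟩
    have : 0 ≤ m / 2 * (1 / (m - r)) := by positivity
    calc 1 / (2 * r / m) = m / 2 * (1 / r) := by field_simp
      _ ≤ _ := by rw [mul_add]; linarith
  · have h1 := two_mul_div_le_sin hm hmr.le (by linarith)
    have e : Real.sin (Real.pi * ((m - r) / m)) = Real.sin (Real.pi * (r / m)) := by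
      rw [← Real.sin_pi_sub]
      congr 1
      field_simp
      ring
    rw [e] at h1
    have h2 : 0 < 2 * (m - r) / m := by positivity
    refine ⟨h2.trans_le h1, (one_div_le_one_div_of_le h2 h1).trans ?_⟩
    have : 0 ≤ m / 2 * (1 / r) := by positivity
    calc 1 / (2 * (m - r) / m) = m / 2 * (1 / (m - r)) := by field_simp
      _ ≤ _ := by rw [mul_add]; linarith

theorem abs_sum_cos_le_sinBound {m a : ℕ} (hm : 0 < m) (ha : ¬ m ∣ a) {u v : ℕ} (huv : u ≤ v) :
    |∑ j ∈ Ioc u v, Real.cos (2 * Real.pi * j * (a / m : ℝ))| ≤ sinBound m a := by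
  have hm' : (0 : ℝ) < m := by exact_mod_cast hm
  have hr : 0 < a % m := Nat.pos_of_ne_zero fun h => ha (Nat.dvd_of_mod_eq_zero h)
  have hrm : a % m < m := Nat.mod_lt _ hm
  obtain ⟨hs, hb⟩ := one_div_sin_le (m := m) (r := (a % m : ℕ)) (by exact_mod_cast hr)
    (by exact_mod_cast hrm)
  have hcos : ∀ j : ℕ, Real.cos (2 * Real.pi * j * (a / m : ℝ)) =
      Real.cos (2 * Real.pi * j * (((a % m : ℕ) : ℝ) / m)) := by
    intro j
    have ha2 : (a : ℝ) = m * (a / m : ℕ) + (a % m : ℕ) := by exact_mod_cast (Nat.div_add_mod a m).symm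
    rw [← Real.cos_add_nat_mul_two_pi (2 * Real.pi * j * (((a % m : ℕ) : ℝ) / m)) (j * (a / m))]
    congr 1
    rw [ha2]
    push_cast
    field_simp
    ring
  simp only [hcos]
  rw [sinBound, if_neg ha]
  refine le_trans ?_ hb
  have h := two_mul_sin_mul_sum_cos (((a % m : ℕ) : ℝ) / m) huv
  rw [le_div_iff₀ hs]
  have h3 : |2 * Real.sin (Real.pi * (((a % m : ℕ) : ℝ) / m)) *
      ∑ j ∈ Ioc u v, Real.cos (2 * Real.pi * j * (((a % m : ℕ) : ℝ) / m))| ≤ 2 := by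
    rw [h, abs_le]
    constructor <;> linarith [Real.sin_le_one ((2 * v + 1) * (Real.pi * (((a % m : ℕ) : ℝ) / m))),
      Real.neg_one_le_sin ((2 * v + 1) * (Real.pi * (((a % m : ℕ) : ℝ) / m))),
      Real.sin_le_one ((2 * u + 1) * (Real.pi * (((a % m : ℕ) : ℝ) / m))),
      Real.neg_one_le_sin ((2 * u + 1) * (Real.pi * (((a % m : ℕ) : ℝ) / m)))]
  rw [abs_mul, abs_mul, abs_of_pos hs, abs_two] at h3
  linarith

theorem sinBound_nonneg (m a : ℕ) : 0 ≤ sinBound m a := by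
  unfold sinBound
  split_ifs with h
  · exact le_rfl
  · rcases Nat.eq_zero_or_pos m with rfl | hm
    · simp
    · have : ((a % m : ℕ) : ℝ) < m := by exact_mod_cast Nat.mod_lt _ hm
      have : (0 : ℝ) < (m : ℝ) - (a % m : ℕ) := sub_pos.mpr this
      positivity

/-- Crude: it only serves the convergence of the series over the frequencies `k`. -/
theorem sinBound_le (m a : ℕ) : sinBound m a ≤ m := by
  unfold sinBound
  split_ifs with h
  · positivity
  · rcases Nat.eq_zero_or_pos m with rfl | hm
    · simp
    · have h1 : (1 : ℝ) ≤ (a % m : ℕ) := by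
        exact_mod_cast Nat.pos_of_ne_zero fun h' => h (Nat.dvd_of_mod_eq_zero h')
      have h2 : (1 : ℝ) ≤ (m : ℝ) - (a % m : ℕ) := by
        have h3 : ((a % m + 1 : ℕ) : ℝ) ≤ m := by exact_mod_cast Nat.mod_lt _ hm
        push_cast at h3 ⊢
        linarith
      have h4 : 1 / ((a % m : ℕ) : ℝ) ≤ 1 := by rw [div_le_one] <;> linarith
      have h5 : 1 / ((m : ℝ) - (a % m : ℕ)) ≤ 1 := by rw [div_le_one] <;> linarith
      have : (0 : ℝ) < m := by exact_mod_cast hm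
      nlinarith

/-- With `g = gcd(m,n)` and `q = m/g`, the condition `m ∣ kn` means `q ∣ k`. Putting `k = ql`
divides each coefficient by `q²` and changes the argument from `H/m` to `H/g`. -/
theorem hasSum_cosCoeff_ite_dvd {m n : ℕ} (hm : 0 < m) (H : ℝ) :
    HasSum (fun k : ℕ => if m ∣ k * n then cosCoeff (H / m) k else 0)
      (Real.pi ^ 2 * ((m.gcd n : ℝ) / m) ^ 2 * fractVar (H / m.gcd n)) := by
  set g := m.gcd n with hg
  have hg0 : 0 < g := Nat.gcd_pos_of_pos_left _ hm
  obtain ⟨q, hq⟩ : g ∣ m := Nat.gcd_dvd_left m n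
  have hq0 : 0 < q := Nat.pos_of_mul_pos_left (hq ▸ hm)
  have hdvd : ∀ k, m ∣ k * n ↔ q ∣ k := by
    intro k
    obtain ⟨n', hn'⟩ : g ∣ n := Nat.gcd_dvd_right m n
    have hcop : Nat.Coprime q n' := by
      have := Nat.coprime_div_gcd_div_gcd (m := m) (n := n) hg0
      rw [← hg] at this
      nth_rewrite 1 [hq] at this
      nth_rewrite 1 [hn'] at this
      rwa [Nat.mul_div_cancel_left _ hg0, Nat.mul_div_cancel_left _ hg0] at this
    rw [hq, hn', mul_left_comm, Nat.mul_dvd_mul_iff_left hg0]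
    exact ⟨fun h => hcop.dvd_of_dvd_mul_right h, fun h => h.mul_right _⟩
  simp only [hdvd]
  have hinj : Function.Injective (fun l : ℕ => q * l) := fun a b h =>
    Nat.eq_of_mul_eq_mul_left hq0 h
  refine (hinj.hasSum_iff ?_).mp ?_
  · intro k hk
    rw [if_neg]
    rintro ⟨l, rfl⟩
    exact hk ⟨l, rfl⟩
  · refine ((hasSum_cosCoeff (H / g)).div_const ((q : ℝ) ^ 2)).of_eq (fun l => ?_) ?_
    · have hgR : (g : ℝ) ≠ 0 := by positivity
      have hqR : (q : ℝ) ≠ 0 := by positivity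
      simp only [Function.comp, dvd_mul_right, if_true, cosCoeff, hq]
      push_cast
      have : 2 * Real.pi * (q * l) * (H / (g * q)) = 2 * Real.pi * l * (H / g) := by
        field_simp
      rw [this, mul_pow, div_div, mul_comm ((l : ℝ) ^ 2)]
    · have hgR : (g : ℝ) ≠ 0 := by positivity
      have hqR : (q : ℝ) ≠ 0 := by positivity
      rw [hq]
      push_cast
      field_simp

theorem summable_cosCoeff_mul_sinBound (m n : ℕ) (t : ℝ) :
    Summable fun k : ℕ => cosCoeff t k * sinBound m (k * n) :=
  Summable.of_nonneg_of_le (fun _ => mul_nonneg (cosCoeff_nonneg _ _) (sinBound_nonneg _ _))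
    (fun _ => mul_le_mul_of_nonneg_left (sinBound_le _ _) (cosCoeff_nonneg _ _))
    ((hasSum_cosCoeff t).summable.mul_right (m : ℝ))

/-- Compare frequency by frequency. If `m ∣ kn`, every sample has cosine `1` and the main term
cancels it exactly, consistently with `sinBound` being `0` there. Every other frequency gives a
geometric sum. -/
theorem abs_sum_fractDiffPrim_sub_add_le {m n : ℕ} (hm : 0 < m) (H : ℝ) {u v : ℕ}
    (huv : u ≤ v) :
    |∑ j ∈ Ioc u v, (fractDiffPrim m H (j * n) - fractDiffPrim m H (j * n - H)) +
      ((v : ℝ) - u) * ((m.gcd n : ℝ) ^ 2 / m * fractVar (H / m.gcd n))| ≤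
    (m : ℝ) / Real.pi ^ 2 * ∑' k : ℕ, cosCoeff (H / m) k * sinBound m (k * n) := by
  have hmR : (0 : ℝ) < m := by exact_mod_cast hm
  have hpi := Real.pi_ne_zero
  have h1 : HasSum (fun k : ℕ => ∑ j ∈ Ioc u v, -((m : ℝ) / Real.pi ^ 2) * (cosCoeff (H / m) k *
      Real.cos (2 * Real.pi * k * (j * n / m))))
      (∑ j ∈ Ioc u v, (fractDiffPrim m H (j * n) - fractDiffPrim m H (j * n - H))) :=
    hasSum_sum fun j _ => hasSum_fractDiffPrim_sub m H (j * n)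
  have h2 := (hasSum_cosCoeff_ite_dvd (n := n) hm H).mul_left ((m : ℝ) / Real.pi ^ 2 * ((v : ℝ) - u))
  have h3 := h1.add h2
  have e : (m : ℝ) / Real.pi ^ 2 * ((v : ℝ) - u) *
      (Real.pi ^ 2 * ((m.gcd n : ℝ) / m) ^ 2 * fractVar (H / m.gcd n)) =
      ((v : ℝ) - u) * ((m.gcd n : ℝ) ^ 2 / m * fractVar (H / m.gcd n)) := by
    field_simp
  rw [e] at h3
  have h4 := (summable_cosCoeff_mul_sinBound m n (H / m)).hasSum.mul_left ((m : ℝ) / Real.pi ^ 2)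
  rw [← Real.norm_eq_abs]
  refine h3.norm_le_of_bounded h4 fun k => ?_
  have hs : ∑ j ∈ Ioc u v, -((m : ℝ) / Real.pi ^ 2) * (cosCoeff (H / m) k *
      Real.cos (2 * Real.pi * k * (j * n / m))) = -((m : ℝ) / Real.pi ^ 2) * (cosCoeff (H / m) k *
      ∑ j ∈ Ioc u v, Real.cos (2 * Real.pi * j * (((k * n : ℕ) : ℝ) / m))) := by
    rw [Finset.mul_sum, Finset.mul_sum]
    refine Finset.sum_congr rfl fun j _ => ?_
    congr 3
    push_cast
    ring
  rw [hs]
  split_ifs with h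
  · have hcos : ∀ j : ℕ, Real.cos (2 * Real.pi * j * (((k * n : ℕ) : ℝ) / m)) = 1 := by
      intro j
      obtain ⟨l, hl⟩ := h
      rw [hl, ← Real.cos_nat_mul_two_pi (j * l)]
      congr 1
      push_cast
      field_simp
    simp only [hcos, sum_const, Nat.card_Ioc, nsmul_eq_mul, Nat.cast_sub huv]
    have : 0 ≤ (m : ℝ) / Real.pi ^ 2 * (cosCoeff (H / m) k * sinBound m (k * n)) :=
      mul_nonneg (by positivity) (mul_nonneg (cosCoeff_nonneg _ _) (sinBound_nonneg _ _))
    refine le_trans (le_of_eq ?_) this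
    rw [norm_eq_zero]
    ring
  · rw [mul_zero, add_zero, norm_mul, norm_mul, norm_neg, Real.norm_of_nonneg (by positivity),
      Real.norm_of_nonneg (cosCoeff_nonneg _ _)]
    gcongr
    · exact cosCoeff_nonneg _ _
    · exact abs_sum_cos_le_sinBound hm h huv

/-- The correlation of two sawtooth differences over `[X, 2X]`. -/
theorem abs_integral_fractDiff_mul_sub_le {m n : ℕ} (hm : 0 < m) (hmn : m ≤ n) {X H : ℝ}
    (hX : 0 ≤ X) (hH : 0 ≤ H) :
    |(∫ x in X..(2 * X), fractDiff m H x * fractDiff n H x) -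
      X * ((m.gcd n : ℝ) ^ 2 / (m * n) * fractVar (H / m.gcd n))| ≤
    11 * H + (m : ℝ) / Real.pi ^ 2 * ∑' k : ℕ, cosCoeff (H / m) k * sinBound m (k * n) := by
  have hn : 0 < n := hm.trans_le hmn
  have hmR : (0 : ℝ) < m := by exact_mod_cast hm
  have hnR : (0 : ℝ) < n := by exact_mod_cast hn
  have hmnR : (m : ℝ) ≤ n := by exact_mod_cast hmn
  have hle : ⌊X / (n : ℝ)⌋₊ ≤ ⌊2 * X / (n : ℝ)⌋₊ := Nat.floor_mono (by gcongr; linarith)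
  -- Both bounds on the antiderivative are needed: `m ≤ n` absorbs the factor `H/n`, and `H` handles
  -- the summand `1`, giving `8H`. The boundary values add `2H` and replacing the number of `j` by
  -- `X/n` adds `H`, whence `11H`.
  have h1 := abs_integral_fractDiff_mul_add_sum_le (X := X) hmR hnR hX hH (B := min (m : ℝ) H)
    (fun x => le_min (abs_fractDiffPrim_le_left hmR H x) (abs_fractDiffPrim_le_right hmR hH x))
  have h2 := abs_sum_fractDiffPrim_sub_add_le (n := n) hm H hle
  have hb1 : 4 * min (m : ℝ) H * (H / n + 1) ≤ 8 * H := by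
    have : min (m : ℝ) H * (H / n) ≤ H := by
      calc min (m : ℝ) H * (H / n) ≤ n * (H / n) := by
            gcongr
            exact (min_le_left _ _).trans hmnR
        _ = H := by field_simp
    have h' : min (m : ℝ) H ≤ H := min_le_right _ _
    linarith
  have hb2 : |H / n * (fractDiffPrim m H (2 * X) - fractDiffPrim m H X)| ≤ 2 * H := by
    rw [abs_mul, abs_of_nonneg (by positivity)]
    calc H / n * |fractDiffPrim m H (2 * X) - fractDiffPrim m H X| ≤ H / n * (2 * n) := by
          gcongr
          have a1 := abs_le.mp (abs_fractDiffPrim_le_left hmR H (2 * X))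
          have a2 := abs_le.mp (abs_fractDiffPrim_le_left hmR H X)
          rw [abs_le]
          constructor <;> linarith
      _ = 2 * H := by field_simp
  set g := m.gcd n with hg
  have hg0 : 0 < g := Nat.gcd_pos_of_pos_left _ hm
  have hgR : (0 : ℝ) < g := by exact_mod_cast hg0
  have hgm : (g : ℝ) ≤ m := by exact_mod_cast Nat.gcd_le_left n hm
  have hV : (g : ℝ) ^ 2 / m * fractVar (H / g) ≤ H := by
    calc (g : ℝ) ^ 2 / m * fractVar (H / g) ≤ (g : ℝ) ^ 2 / m * (H / g) := by
          gcongr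
          exact fractVar_le_self (by positivity)
      _ = H * (g / m) := by field_simp
      _ ≤ H * 1 := by gcongr; rw [div_le_one hmR]; exact hgm
      _ = H := mul_one H
  have hV0 : 0 ≤ (g : ℝ) ^ 2 / m * fractVar (H / g) :=
    mul_nonneg (by positivity) (fractVar_nonneg _)
  have hJ : |((⌊2 * X / (n : ℝ)⌋₊ : ℝ) - ⌊X / (n : ℝ)⌋₊) - X / n| ≤ 1 := by
    have a1 := Nat.floor_le (a := 2 * X / (n : ℝ)) (by positivity)
    have a2 := Nat.lt_floor_add_one (2 * X / (n : ℝ))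
    have a3 := Nat.floor_le (a := X / (n : ℝ)) (by positivity)
    have a4 := Nat.lt_floor_add_one (X / (n : ℝ))
    have a5 : 2 * X / (n : ℝ) = 2 * (X / n) := by ring
    rw [abs_le]
    constructor <;> linarith
  have hb3 : |(((⌊2 * X / (n : ℝ)⌋₊ : ℝ) - ⌊X / (n : ℝ)⌋₊) - X / n) *
      ((g : ℝ) ^ 2 / m * fractVar (H / g))| ≤ H := by
    rw [abs_mul, abs_of_nonneg hV0]
    calc _ ≤ 1 * H := by gcongr
      _ = H := one_mul H
  have e : X * ((g : ℝ) ^ 2 / (m * n) * fractVar (H / g)) =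
      X / n * ((g : ℝ) ^ 2 / m * fractVar (H / g)) := by field_simp
  rw [e]
  rw [sub_mul] at hb3
  rw [abs_le] at h1 h2 hb2 hb3 ⊢
  constructor <;> linarith [h1.1, h1.2, h2.1, h2.2, hb2.1, hb2.2, hb3.1, hb3.2]

/-! ### Averages of the reciprocal-sine bound with weight `1/n` -/

theorem sum_range_one_div_le (n : ℕ) :
    ∑ i ∈ range n, 1 / ((i : ℝ) + 1) ≤ 1 + Real.log n := by
  refine le_trans (le_of_eq ?_) (harmonic_le_one_add_log n)
  simp [harmonic]

theorem sum_Icc_one_div_le (n : ℕ) : ∑ i ∈ Icc 1 n, 1 / (i : ℝ) ≤ 1 + Real.log n := by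
  refine le_trans (le_of_eq ?_) (sum_range_one_div_le n)
  rw [← Finset.Ico_add_one_right_eq_Icc, Finset.sum_Ico_eq_sum_range]
  simp [add_comm]

theorem sinBound_mod (m a : ℕ) : sinBound m (a % m) = sinBound m a := by
  simp only [sinBound, Nat.mod_mod, Nat.dvd_mod_iff (dvd_refl m)]

theorem sinBound_mul_mul {h : ℕ} (hh : 0 < h) (m a : ℕ) :
    sinBound (h * m) (h * a) = sinBound m a := by
  simp only [sinBound, Nat.mul_dvd_mul_iff_left hh, Nat.mul_mod_mul_left]
  have : (h : ℝ) ≠ 0 := by positivity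
  push_cast
  rw [← mul_sub]
  congr 1
  rw [one_div, one_div, one_div, one_div, mul_inv, mul_inv]
  field_simp

/-- The reflection `r ↦ q - r` turns the second reciprocal into the first, leaving a harmonic sum.
-/
theorem sum_range_sinBound_le (q : ℕ) :
    ∑ t ∈ range q, sinBound q t ≤ q * (1 + Real.log q) := by
  rcases q with _ | q
  · simp
  · rw [Finset.sum_range_succ']
    have h0 : sinBound (q + 1) 0 = 0 := by simp [sinBound]
    have h1 : ∀ i ∈ range q, sinBound (q + 1) (i + 1) =
        ((q + 1 : ℕ) : ℝ) / 2 * (1 / ((i : ℝ) + 1) + 1 / (((q - 1 - i : ℕ) : ℝ) + 1)) := by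
      intro i hi
      rw [mem_range] at hi
      have hlt : i + 1 < q + 1 := by omega
      rw [sinBound, if_neg (Nat.not_dvd_of_pos_of_lt (by omega) hlt), Nat.mod_eq_of_lt hlt]
      have : ((q - 1 - i : ℕ) : ℝ) = q - 1 - i := by
        rw [Nat.cast_sub (by omega), Nat.cast_sub (by omega)]
        simp
      rw [this]
      push_cast
      congr 3
      ring
    rw [h0, Finset.sum_congr rfl h1, ← Finset.mul_sum, Finset.sum_add_distrib,
      Finset.sum_range_reflect (fun j : ℕ => 1 / ((j : ℝ) + 1)) q]
    have h2 := sum_range_one_div_le q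
    have h3 : Real.log q ≤ Real.log (q + 1 : ℕ) := by
      rcases Nat.eq_zero_or_pos q with rfl | hq
      · simp
      · exact Real.log_le_log (by exact_mod_cast hq) (by push_cast; linarith)
    calc _ = ((q + 1 : ℕ) : ℝ) * ∑ i ∈ range q, 1 / ((i : ℝ) + 1) := by ring
      _ ≤ _ := by gcongr; linarith

/-- Multiplication by a unit permutes the residues modulo `q`. -/
theorem sum_range_sinBound_mul {k q : ℕ} (h : k.Coprime q) :
    ∑ s ∈ range q, sinBound q (k * s) = ∑ t ∈ range q, sinBound q t := by
  have hmaps : ∀ s ∈ range q, k * s % q ∈ range q := fun s hs =>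
    mem_range.mpr (Nat.mod_lt _ ((Nat.zero_le s).trans_lt (mem_range.mp hs)))
  have hinj : Set.InjOn (fun s => k * s % q) (range q) := by
    intro a ha b hb hab
    have h1 : k * a ≡ k * b [MOD q] := hab
    have h2 : a ≡ b [MOD q] := Nat.ModEq.cancel_left_of_coprime (by rwa [Nat.gcd_comm]) h1
    rw [coe_range, Set.mem_Iio] at ha hb
    exact h2.eq_of_lt_of_lt ha hb
  refine Finset.sum_nbij (fun s => k * s % q) hmaps hinj ?_ fun s _ => (sinBound_mod _ _).symm
  exact Finset.surjOn_of_injOn_of_card_le _ hmaps hinj le_rfl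

/-- Cut the range into blocks `[iq, iq + q)`. Each is a full residue system with denominators at
least `iq`, so it contributes at most `(1 + log q)/i`. Starting at `n = q` is what excludes the
block `i = 0`. -/
theorem sum_Icc_sinBound_div_le_of_coprime {k q : ℕ} (h : k.Coprime q) (hq : 0 < q) (M : ℕ) :
    ∑ n ∈ Icc q M, sinBound q (k * n) / n ≤ (1 + Real.log M) ^ 2 := by
  rcases lt_or_ge M q with hM | hM
  · rw [Finset.Icc_eq_empty (by omega)]
    simp [sq_nonneg]
  have hM0 : 0 < M := hq.trans_le hM
  have hqR : (0 : ℝ) < q := by exact_mod_cast hq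
  have hlq : Real.log q ≤ Real.log M := Real.log_le_log hqR (by exact_mod_cast hM)
  have hl0 : 0 ≤ Real.log M := Real.log_nonneg (by exact_mod_cast hM0)
  have hmaps : ∀ n ∈ Icc q M, n / q ∈ Icc 1 M := by
    intro n hn
    rw [mem_Icc] at hn ⊢
    exact ⟨Nat.div_pos hn.1 hq, (Nat.div_le_self _ _).trans hn.2⟩
  rw [← Finset.sum_fiberwise_of_maps_to hmaps]
  have hfib : ∀ i ∈ Icc 1 M, ∑ n ∈ Icc q M with n / q = i, sinBound q (k * n) / n ≤
      1 / (i : ℝ) * (1 + Real.log M) := by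
    intro i hi
    rw [mem_Icc] at hi
    have hiR : (0 : ℝ) < i := by exact_mod_cast hi.1
    have hsub : (Icc q M).filter (fun n => n / q = i) ⊆ Ico (i * q) (i * q + q) := by
      intro n hn
      rw [mem_filter] at hn
      rw [mem_Ico]
      have := Nat.div_add_mod n q
      have h2 := Nat.mod_lt n hq
      rw [hn.2, mul_comm] at this
      omega
    calc ∑ n ∈ Icc q M with n / q = i, sinBound q (k * n) / n
        ≤ ∑ n ∈ Ico (i * q) (i * q + q), sinBound q (k * n) / (i * q) := by
          refine (Finset.sum_le_sum_of_subset_of_nonneg hsub fun n _ _ =>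
            div_nonneg (sinBound_nonneg _ _) (by positivity)).trans
            (Finset.sum_le_sum fun n hn => ?_)
          rw [mem_Ico] at hn
          have : ((i : ℝ) * q) ≤ n := by exact_mod_cast hn.1
          exact div_le_div_of_nonneg_left (sinBound_nonneg _ _) (by positivity) this
      _ = (∑ s ∈ range q, sinBound q (k * s)) / (i * q) := by
          rw [← Finset.sum_div, Finset.sum_Ico_eq_sum_range, add_tsub_cancel_left]
          congr 1
          refine Finset.sum_congr rfl fun s _ => ?_
          rw [← sinBound_mod, ← sinBound_mod q (k * s)]
          congr 1
          rw [mul_add, ← mul_assoc, Nat.mul_add_mod_self_right]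
      _ ≤ (q * (1 + Real.log q)) / (i * q) := by
          gcongr
          rw [sum_range_sinBound_mul h]
          exact sum_range_sinBound_le q
      _ = 1 / (i : ℝ) * (1 + Real.log q) := by field_simp
      _ ≤ _ := by gcongr
  refine (Finset.sum_le_sum hfib).trans ?_
  rw [← Finset.sum_mul, sq]
  gcongr
  exact sum_Icc_one_div_le M

/-- `sinBound` depends only on the fraction `kn/m`, so the common factor of `k` and `m` cancels; the
range is then enlarged to start at the reduced modulus. -/
theorem sum_Icc_sinBound_div_le {m : ℕ} (hm : 0 < m) (k M : ℕ) :
    ∑ n ∈ Icc m M, sinBound m (k * n) / n ≤ (1 + Real.log M) ^ 2 := by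
  obtain ⟨h, k', q, hh, hcop, rfl, rfl⟩ := Nat.exists_coprime' (Nat.gcd_pos_of_pos_right k hm)
  have hq : 0 < q := Nat.pos_of_mul_pos_right hm
  have hsub : Icc (q * h) M ⊆ Icc q M := Finset.Icc_subset_Icc_left (Nat.le_mul_of_pos_right _ hh)
  refine le_trans ?_ (sum_Icc_sinBound_div_le_of_coprime hcop hq M)
  refine (Finset.sum_le_sum_of_subset_of_nonneg hsub fun n _ _ =>
    div_nonneg (sinBound_nonneg _ _) (by positivity)).trans (le_of_eq ?_)
  refine Finset.sum_congr rfl fun n _ => ?_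
  rw [mul_comm q h, mul_comm k' h, mul_assoc, sinBound_mul_mul hh]

/-- After exchanging sums, the weights over `k` total `π² fractVar(H/m) ≤ π² H/m`, which cancels the
factor `m`: the bound is uniform in `m`. -/
theorem sum_Icc_tsum_cosCoeff_mul_sinBound_div_le {m : ℕ} (hm : 0 < m) (M : ℕ) {H : ℝ}
    (hH : 0 ≤ H) :
    ∑ n ∈ Icc m M, ((m : ℝ) / Real.pi ^ 2 *
      ∑' k : ℕ, cosCoeff (H / m) k * sinBound m (k * n)) / n ≤ H * (1 + Real.log M) ^ 2 := by
  have hmR : (0 : ℝ) < m := by exact_mod_cast hm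
  have h1 : HasSum (fun k : ℕ => ∑ n ∈ Icc m M,
      (m : ℝ) / Real.pi ^ 2 * (cosCoeff (H / m) k * sinBound m (k * n)) / n)
      (∑ n ∈ Icc m M, ((m : ℝ) / Real.pi ^ 2 *
        ∑' k : ℕ, cosCoeff (H / m) k * sinBound m (k * n)) / n) :=
    hasSum_sum fun n _ =>
      ((summable_cosCoeff_mul_sinBound m n (H / m)).hasSum.mul_left _).div_const _
  have h2 := (hasSum_cosCoeff (H / m)).mul_left ((m : ℝ) / Real.pi ^ 2 * (1 + Real.log M) ^ 2)
  refine (hasSum_le (fun k => ?_) h1 h2).trans ?_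
  · have : ∑ n ∈ Icc m M, (m : ℝ) / Real.pi ^ 2 * (cosCoeff (H / m) k * sinBound m (k * n)) / n =
        (m : ℝ) / Real.pi ^ 2 * cosCoeff (H / m) k * ∑ n ∈ Icc m M, sinBound m (k * n) / n := by
      rw [Finset.mul_sum]
      exact Finset.sum_congr rfl fun n _ => by ring
    rw [this]
    have hc := cosCoeff_nonneg (H / m) k
    calc _ ≤ (m : ℝ) / Real.pi ^ 2 * cosCoeff (H / m) k * (1 + Real.log M) ^ 2 := by
          gcongr
          exact sum_Icc_sinBound_div_le hm k M
      _ = _ := by ring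
  · calc (m : ℝ) / Real.pi ^ 2 * (1 + Real.log M) ^ 2 * (Real.pi ^ 2 * fractVar (H / m))
        = (m * fractVar (H / m)) * (1 + Real.log M) ^ 2 := by
          have := Real.pi_ne_zero
          field_simp
      _ ≤ (m * (H / m)) * (1 + Real.log M) ^ 2 := by
          gcongr
          exact fractVar_le_self (by positivity)
      _ = H * (1 + Real.log M) ^ 2 := by field_simp

/-! ### Mean square of a finite sum of sawtooth differences -/

theorem sum_sum_le_two_mul_of_symm {F : ℕ → ℕ → ℝ} (hF : ∀ m n, 0 ≤ F m n)
    (hsymm : ∀ m n, F m n = F n m) (M : ℕ) :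
    ∑ m ∈ Icc 1 M, ∑ n ∈ Icc 1 M, F m n ≤ 2 * ∑ m ∈ Icc 1 M, ∑ n ∈ Icc m M, F m n := by
  have hfil : ∀ m ∈ Icc 1 M, ∑ n ∈ Icc m M, F m n =
      ∑ n ∈ Icc 1 M, if m ≤ n then F m n else 0 := by
    intro m hm
    rw [← Finset.sum_filter]
    congr 1
    ext n
    simp only [mem_Icc, mem_filter] at hm ⊢
    omega
  rw [Finset.sum_congr rfl hfil, two_mul]
  nth_rewrite 2 [Finset.sum_comm]
  rw [← Finset.sum_add_distrib]
  refine Finset.sum_le_sum fun m _ => ?_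
  rw [← Finset.sum_add_distrib]
  refine Finset.sum_le_sum fun n _ => ?_
  rcases le_total m n with h | h
  · rw [if_pos h]
    split_ifs <;> linarith [hF n m]
  · rw [if_pos h, hsymm m n]
    split_ifs <;> linarith [hF n m]

theorem norm_sum_mul_ofReal_sq (s : Finset ℕ) (a : ℕ → ℂ) (f : ℕ → ℝ) :
    ‖∑ n ∈ s, a n * (f n : ℂ)‖ ^ 2 =
      ∑ m ∈ s, ∑ n ∈ s, (a m * (starRingEnd ℂ) (a n)).re * (f m * f n) := by
  have h : ((‖∑ n ∈ s, a n * (f n : ℂ)‖ ^ 2 : ℝ) : ℂ) =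
      ∑ m ∈ s, ∑ n ∈ s, a m * (starRingEnd ℂ) (a n) * ((f m * f n : ℝ) : ℂ) := by
    push_cast
    rw [← Complex.mul_conj', map_sum, Finset.sum_mul_sum]
    refine Finset.sum_congr rfl fun m _ => Finset.sum_congr rfl fun n _ => ?_
    rw [map_mul, Complex.conj_ofReal]
    ring
  have h2 := congrArg Complex.re h
  rw [Complex.ofReal_re] at h2
  rw [h2, Complex.re_sum]
  refine Finset.sum_congr rfl fun m _ => ?_
  rw [Complex.re_sum]
  exact Finset.sum_congr rfl fun n _ => Complex.re_mul_ofReal _ _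

/-- The mean of `fractDiff m H * fractDiff n H` over a common period. -/
noncomputable def fractCorr (H : ℝ) (m n : ℕ) : ℝ :=
  (m.gcd n : ℝ) ^ 2 / (m * n) * fractVar (H / m.gcd n)

theorem fractCorr_comm (H : ℝ) (m n : ℕ) : fractCorr H m n = fractCorr H n m := by
  rw [fractCorr, fractCorr, Nat.gcd_comm, mul_comm (m : ℝ)]

theorem fractCorr_nonneg (H : ℝ) (m n : ℕ) : 0 ≤ fractCorr H m n :=
  mul_nonneg (by positivity) (fractVar_nonneg _)

theorem intervalIntegrable_fractDiff_mul (m n H a b : ℝ) :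
    IntervalIntegrable (fun x => fractDiff m H x * fractDiff n H x) volume a b := by
  refine (intervalIntegrable_const (c := (1 : ℝ))).mono_fun
    ((measurable_fractDiff m H).mul (measurable_fractDiff n H)).aestronglyMeasurable
    (Eventually.of_forall fun x => ?_)
  simp only [norm_mul, norm_one]
  exact mul_le_one₀ (abs_fractDiff_le_one m H x) (norm_nonneg _) (abs_fractDiff_le_one n H x)

/-- By symmetry only `m ≤ n` matters, which is where the correlation estimate applies. Two
logarithms come from the sum over `n` and one from `∑ 1/m`; the constant is `24 = 2 (11 + 1)`, with
`L² ≤ L³` since `L ≥ 1`. -/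
theorem abs_integral_norm_sum_sq_sub_le {a : ℕ → ℂ} {B X H : ℝ} {M : ℕ}
    (hX : 0 ≤ X) (hH : 0 ≤ H) (ha : ∀ n ∈ Icc 1 M, ‖a n‖ ≤ B / n) :
    |(∫ x in X..(2 * X), ‖∑ n ∈ Icc 1 M, a n * (fractDiff n H x : ℂ)‖ ^ 2) -
      X * ∑ m ∈ Icc 1 M, ∑ n ∈ Icc 1 M, (a m * (starRingEnd ℂ) (a n)).re * fractCorr H m n| ≤
    24 * B ^ 2 * H * (1 + Real.log M) ^ 3 := by
  rcases Nat.eq_zero_or_pos M with rfl | hM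
  · simp only [zero_lt_one, Icc_eq_empty_of_lt, sum_empty]
    simp
    positivity
  set E : ℕ → ℕ → ℝ := fun m n =>
    (∫ x in X..(2 * X), fractDiff m H x * fractDiff n H x) - X * fractCorr H m n with hE
  set c : ℕ → ℕ → ℝ := fun m n => (a m * (starRingEnd ℂ) (a n)).re with hc
  set L : ℝ := 1 + Real.log M with hL
  have hL1 : 1 ≤ L := by
    have : 0 ≤ Real.log M := Real.log_nonneg (by exact_mod_cast hM)
    linarith
  have hB : 0 ≤ B := by
    have := (norm_nonneg _).trans (ha 1 (by simp; omega))
    simpa using this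
  have h1 : (∫ x in X..(2 * X), ‖∑ n ∈ Icc 1 M, a n * (fractDiff n H x : ℂ)‖ ^ 2) -
      X * ∑ m ∈ Icc 1 M, ∑ n ∈ Icc 1 M, c m n * fractCorr H m n =
      ∑ m ∈ Icc 1 M, ∑ n ∈ Icc 1 M, c m n * E m n := by
    simp only [norm_sum_mul_ofReal_sq (Icc 1 M) a (fun n => fractDiff n H _)]
    rw [intervalIntegral.integral_finsetSum, Finset.mul_sum, ← Finset.sum_sub_distrib]
    · refine Finset.sum_congr rfl fun m _ => ?_
      rw [intervalIntegral.integral_finsetSum, Finset.mul_sum, ← Finset.sum_sub_distrib]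
      · refine Finset.sum_congr rfl fun n _ => ?_
        rw [intervalIntegral.integral_const_mul]
        ring
      · exact fun n _ => (intervalIntegrable_fractDiff_mul m n H _ _).const_mul _
    · intro m _
      have h := IntervalIntegrable.sum (Icc 1 M) (μ := volume) (a := X) (b := 2 * X)
        (f := fun (n : ℕ) x => (a m * (starRingEnd ℂ) (a n)).re *
          (fractDiff m H x * fractDiff n H x)) fun n _ =>
          (intervalIntegrable_fractDiff_mul m n H _ _).const_mul _
      refine h.congr fun x _ => ?_
      simp
  rw [h1]
  have hEsymm : ∀ m n, E m n = E n m := fun m n => by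
    simp only [hE, fractCorr_comm H m n, mul_comm (fractDiff m H _)]
  have hc_le : ∀ m n, |c m n| ≤ ‖a m‖ * ‖a n‖ := fun m n => by
    refine (Complex.abs_re_le_norm _).trans (le_of_eq ?_)
    rw [norm_mul, Complex.norm_conj]
  have hF : ∀ m ∈ Icc 1 M, ∀ n ∈ Icc 1 M, |c m n * E m n| ≤ ‖a m‖ * ‖a n‖ * |E m n| := by
    intro m _ n _
    rw [abs_mul]
    gcongr
    exact hc_le m n
  calc |∑ m ∈ Icc 1 M, ∑ n ∈ Icc 1 M, c m n * E m n|
      ≤ ∑ m ∈ Icc 1 M, ∑ n ∈ Icc 1 M, ‖a m‖ * ‖a n‖ * |E m n| := by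
        refine (Finset.abs_sum_le_sum_abs _ _).trans (Finset.sum_le_sum fun m hm => ?_)
        exact (Finset.abs_sum_le_sum_abs _ _).trans (Finset.sum_le_sum fun n hn => hF m hm n hn)
    _ ≤ 2 * ∑ m ∈ Icc 1 M, ∑ n ∈ Icc m M, ‖a m‖ * ‖a n‖ * |E m n| :=
        sum_sum_le_two_mul_of_symm (fun m n => by positivity)
          (fun m n => by rw [hEsymm m n, mul_comm ‖a m‖]) M
    _ ≤ 2 * ∑ m ∈ Icc 1 M, 1 / (m : ℝ) * (B ^ 2 * (11 * H * L + H * L ^ 2)) := by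
        gcongr with m hm
        rw [mem_Icc] at hm
        have hm0 : 0 < m := hm.1
        have hmR : (0 : ℝ) < m := by exact_mod_cast hm0
        set T : ℕ → ℝ := fun n =>
          (m : ℝ) / Real.pi ^ 2 * ∑' k : ℕ, cosCoeff (H / m) k * sinBound m (k * n) with hT
        have hterm : ∀ n ∈ Icc m M, ‖a m‖ * ‖a n‖ * |E m n| ≤
            1 / (m : ℝ) * (B ^ 2 * (11 * H * (1 / (n : ℝ)) + T n / n)) := by
          intro n hn
          rw [mem_Icc] at hn
          have hnR : (0 : ℝ) < n := by exact_mod_cast hm0.trans_le hn.1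
          have h2 : |E m n| ≤ 11 * H + T n := abs_integral_fractDiff_mul_sub_le hm0 hn.1 hX hH
          calc ‖a m‖ * ‖a n‖ * |E m n| ≤ (B / m) * (B / n) * (11 * H + T n) := by
                gcongr
                · exact ha m (mem_Icc.mpr hm)
                · exact ha n (mem_Icc.mpr ⟨hm.1.trans hn.1, hn.2⟩)
            _ = _ := by ring
        refine (Finset.sum_le_sum hterm).trans ?_
        rw [← Finset.mul_sum, ← Finset.mul_sum, Finset.sum_add_distrib, ← Finset.mul_sum]
        gcongr
        · refine (Finset.sum_le_sum_of_subset_of_nonneg (Finset.Icc_subset_Icc_left hm.1)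
            fun _ _ _ => by positivity).trans (sum_Icc_one_div_le M)
        · exact sum_Icc_tsum_cosCoeff_mul_sinBound_div_le hm0 M hH
    _ ≤ 2 * (L * (B ^ 2 * (11 * H * L + H * L ^ 2))) := by
        rw [← Finset.sum_mul]
        gcongr
        exact sum_Icc_one_div_le M
    _ ≤ 24 * B ^ 2 * H * L ^ 3 := by
        have h3 : L ^ 2 ≤ L ^ 3 := pow_le_pow_right₀ hL1 (by norm_num)
        have h4 : 0 ≤ B ^ 2 * H := by positivity
        nlinarith

/-! ### Multiplicative functions supported on squarefree integers -/

/-- The multiplicative function supported on squarefree integers with value `y p` at primes. -/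
def sqfreeProd {R : Type*} [CommRing R] (y : ℕ → R) (n : ℕ) : R :=
  open Classical in if Squarefree n then ∏ p ∈ n.primeFactors, y p else 0

section Ring

variable {R : Type*} [CommRing R]

theorem sqfreeProd_of_squarefree (y : ℕ → R) {n : ℕ} (hn : Squarefree n) :
    sqfreeProd y n = ∏ p ∈ n.primeFactors, y p := if_pos hn

theorem sqfreeProd_of_not_squarefree (y : ℕ → R) {n : ℕ} (hn : ¬ Squarefree n) :
    sqfreeProd y n = 0 := if_neg hn

theorem sqfreeProd_zero (y : ℕ → R) : sqfreeProd y 0 = 0 :=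
  sqfreeProd_of_not_squarefree y not_squarefree_zero

theorem sqfreeProd_one (y : ℕ → R) : sqfreeProd y 1 = 1 := by
  rw [sqfreeProd_of_squarefree y squarefree_one]
  simp

theorem sqfreeProd_mul (y : ℕ → R) {m n : ℕ} (h : m.Coprime n) :
    sqfreeProd y (m * n) = sqfreeProd y m * sqfreeProd y n := by
  by_cases hm : Squarefree m
  · by_cases hn : Squarefree n
    · rw [sqfreeProd_of_squarefree y hm, sqfreeProd_of_squarefree y hn,
        sqfreeProd_of_squarefree y ((Nat.squarefree_mul h).mpr ⟨hm, hn⟩), h.primeFactors_mul,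
        Finset.prod_union h.disjoint_primeFactors]
    · rw [sqfreeProd_of_not_squarefree y hn, mul_zero,
        sqfreeProd_of_not_squarefree y fun h' => hn ((Nat.squarefree_mul h).mp h').2]
  · rw [sqfreeProd_of_not_squarefree y hm, zero_mul,
      sqfreeProd_of_not_squarefree y fun h' => hm ((Nat.squarefree_mul h).mp h').1]

theorem sqfreeProd_mul_of_not_coprime (y : ℕ → R) {m n : ℕ} (h : ¬ m.Coprime n) :
    sqfreeProd y (m * n) = 0 :=
  sqfreeProd_of_not_squarefree y fun h' => h (Nat.coprime_of_squarefree_mul h')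

theorem sqfreeProd_prime (y : ℕ → R) {p : ℕ} (hp : p.Prime) : sqfreeProd y p = y p := by
  rw [sqfreeProd_of_squarefree y hp.squarefree, hp.primeFactors, Finset.prod_singleton]

theorem sqfreeProd_prime_pow (y : ℕ → R) {p k : ℕ} (hp : p.Prime) (hk : 2 ≤ k) :
    sqfreeProd y (p ^ k) = 0 := by
  refine sqfreeProd_of_not_squarefree y fun h => ?_
  have := (Nat.squarefree_pow_iff hp.ne_one (by omega)).mp h
  omega

theorem sqfreeProd_congr {y z : ℕ → R} {n : ℕ} (h : ∀ p ∈ n.primeFactors, y p = z p) :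
    sqfreeProd y n = sqfreeProd z n := by
  by_cases hn : Squarefree n
  · rw [sqfreeProd_of_squarefree y hn, sqfreeProd_of_squarefree z hn]
    exact Finset.prod_congr rfl h
  · rw [sqfreeProd_of_not_squarefree y hn, sqfreeProd_of_not_squarefree z hn]

theorem map_sqfreeProd {S : Type*} [CommRing S] (φ : R →+* S) (y : ℕ → R) (n : ℕ) :
    φ (sqfreeProd y n) = sqfreeProd (fun p => φ (y p)) n := by
  by_cases hn : Squarefree n
  · rw [sqfreeProd_of_squarefree _ hn, sqfreeProd_of_squarefree _ hn, map_prod]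
  · rw [sqfreeProd_of_not_squarefree _ hn, sqfreeProd_of_not_squarefree _ hn, map_zero]

theorem sqfreeProd_mul_natCast_pow (y : ℕ → R) (k n : ℕ) :
    sqfreeProd (fun p => y p * (p : R) ^ k) n = sqfreeProd y n * (n : R) ^ k := by
  by_cases hn : Squarefree n
  · rw [sqfreeProd_of_squarefree _ hn, sqfreeProd_of_squarefree _ hn, Finset.prod_mul_distrib,
      Finset.prod_pow]
    congr 2
    rw [← Nat.cast_prod, Nat.prod_primeFactors_of_squarefree hn]
  · rw [sqfreeProd_of_not_squarefree _ hn, sqfreeProd_of_not_squarefree _ hn, zero_mul]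

/-- A coprimality condition is encoded in the local values, so that it survives in an Euler product.
-/
theorem sqfreeProd_ite_dvd (y : ℕ → R) {m n : ℕ} (hn : n ≠ 0) :
    sqfreeProd (fun p => if p ∣ m then 0 else y p) n =
      if m.Coprime n then sqfreeProd y n else 0 := by
  split_ifs with h
  · refine sqfreeProd_congr fun p hp => if_neg fun hpm => ?_
    rw [Nat.mem_primeFactors] at hp
    exact Nat.not_coprime_of_dvd_of_dvd hp.1.one_lt hpm hp.2.1 h
  · obtain ⟨p, hp, hpm, hpn⟩ := Nat.Prime.not_coprime_iff_dvd.mp h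
    by_cases hs : Squarefree n
    · rw [sqfreeProd_of_squarefree _ hs]
      exact Finset.prod_eq_zero (Nat.mem_primeFactors.mpr ⟨hp, hpn, hn⟩) (if_pos hpm)
    · exact sqfreeProd_of_not_squarefree _ hs

theorem prod_primeFactors_one_add (y : ℕ → R) {n : ℕ} (hn : n ≠ 0) :
    ∏ p ∈ n.primeFactors, (1 + y p) = ∑ d ∈ n.divisors, sqfreeProd y d := by
  classical
  have h1 : ∑ d ∈ n.divisors, sqfreeProd y d =
      ∑ d ∈ n.divisors with Squarefree d, ∏ p ∈ d.primeFactors, y p := by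
    rw [Finset.sum_filter]
    exact Finset.sum_congr rfl fun d _ => by unfold sqfreeProd; congr
  rw [h1, Finset.prod_one_add]
  symm
  refine Finset.sum_nbij' (fun d => d.primeFactors) (fun s => ∏ p ∈ s, p) ?_ ?_ ?_ ?_ ?_
  · intro d hd
    simp only [mem_filter, Nat.mem_divisors] at hd
    exact mem_powerset.mpr (Nat.primeFactors_mono hd.1.1 hn)
  · intro s hs
    have hs' := mem_powerset.mp hs
    have hsp : ∀ p ∈ s, p.Prime := fun p hp => Nat.prime_of_mem_primeFactors (hs' hp)
    simp only [mem_filter, Nat.mem_divisors]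
    refine ⟨⟨(Finset.prod_dvd_prod_of_subset _ _ _ hs').trans (Nat.prod_primeFactors_dvd n), hn⟩, ?_⟩
    refine Finset.squarefree_prod_of_pairwise_isCoprime ?_ fun p hp => (hsp p hp).squarefree
    intro p hp q hq hpq
    exact Nat.coprime_iff_isRelPrime.mp ((Nat.coprime_primes (hsp p hp) (hsp q hq)).mpr hpq)
  · intro d hd
    simp only [mem_filter] at hd
    exact Nat.prod_primeFactors_of_squarefree hd.2
  · intro s hs
    exact Nat.primeFactors_prod fun p hp =>
      Nat.prime_of_mem_primeFactors (mem_powerset.mp hs hp)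
  · intro d _
    rfl

/-- Expanding the product sends each prime of a squarefree `n` to one of two coprime factors. If `n`
is not squarefree, every coprime factorisation has a factor that is not squarefree, and both sides
vanish. -/
theorem sqfreeProd_add (y z : ℕ → R) (n : ℕ) :
    sqfreeProd (fun p => y p + z p) n = ∑ x ∈ n.divisorsAntidiagonal,
      if x.1.Coprime x.2 then sqfreeProd y x.1 * sqfreeProd z x.2 else 0 := by
  by_cases hn : Squarefree n
  · have h := (ArithmeticFunction.IsMultiplicative.prodPrimeFactors
      y).prodPrimeFactors_add_of_squarefree
      (ArithmeticFunction.IsMultiplicative.prodPrimeFactors z) hn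
    rw [ArithmeticFunction.mul_apply, ArithmeticFunction.prodPrimeFactors_apply hn.ne_zero] at h
    rw [sqfreeProd_of_squarefree _ hn]
    have e : ∏ p ∈ n.primeFactors, (y p + z p) = ∏ p ∈ n.primeFactors,
        (ArithmeticFunction.prodPrimeFactors y + ArithmeticFunction.prodPrimeFactors z) p := by
      refine Finset.prod_congr rfl fun p hp => ?_
      have hp' := Nat.prime_of_mem_primeFactors hp
      rw [ArithmeticFunction.add_apply, ArithmeticFunction.prodPrimeFactors_apply hp'.ne_zero,
        ArithmeticFunction.prodPrimeFactors_apply hp'.ne_zero, hp'.primeFactors]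
      simp
    rw [e, h]
    refine Finset.sum_congr rfl fun x hx => ?_
    rw [Nat.mem_divisorsAntidiagonal] at hx
    have hx' := hx.1 ▸ hn
    have hcop := Nat.coprime_of_squarefree_mul hx'
    have hs := (Nat.squarefree_mul hcop).mp hx'
    rw [if_pos hcop, sqfreeProd_of_squarefree _ hs.1, sqfreeProd_of_squarefree _ hs.2,
      ArithmeticFunction.prodPrimeFactors_apply hs.1.ne_zero,
      ArithmeticFunction.prodPrimeFactors_apply hs.2.ne_zero]
  · rw [sqfreeProd_of_not_squarefree _ hn]
    symm
    refine Finset.sum_eq_zero fun x hx => ?_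
    rw [Nat.mem_divisorsAntidiagonal] at hx
    split_ifs with hcop
    · by_cases h1 : Squarefree x.1
      · have h2 : ¬ Squarefree x.2 := fun h2 =>
          hn (hx.1 ▸ (Nat.squarefree_mul hcop).mpr ⟨h1, h2⟩)
        rw [sqfreeProd_of_not_squarefree z h2, mul_zero]
      · rw [sqfreeProd_of_not_squarefree y h1, zero_mul]
    · rfl

end Ring

section Normed

variable {R : Type*} [NormedField R]

/-- The divisor bound. -/
theorem exists_norm_sqfreeProd_le (R : Type*) [NormedField R] (A : ℝ) {η : ℝ} (hη : 0 < η) :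
    ∃ C : ℝ, 0 ≤ C ∧ ∀ y : ℕ → R, (∀ p : ℕ, p.Prime → ‖y p‖ ≤ A) →
      ∀ n : ℕ, ‖sqfreeProd y n‖ ≤ C * (n : ℝ) ^ η := by
  set B := max A 1 with hB
  have hB1 : 1 ≤ B := le_max_right _ _
  -- Primes from `P` on are paid for by `p^η`; fewer than `P + 1` primes remain, each costing a
  -- factor `B`.
  obtain ⟨P, hP⟩ : ∃ P : ℕ, ∀ p : ℕ, P ≤ p → B ≤ (p : ℝ) ^ η := by
    have h := ((tendsto_rpow_atTop hη).comp tendsto_natCast_atTop_atTop).eventually_ge_atTop B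
    exact eventually_atTop.mp h
  refine ⟨B ^ P, by positivity, fun y hy n => ?_⟩
  by_cases hn : Squarefree n
  · rw [sqfreeProd_of_squarefree _ hn, norm_prod]
    have h1 : ∀ p ∈ n.primeFactors, ‖y p‖ ≤ (if p < P then B else 1) * (p : ℝ) ^ η := by
      intro p hp
      have hpp := Nat.prime_of_mem_primeFactors hp
      have hyp : ‖y p‖ ≤ B := (hy p hpp).trans (le_max_left _ _)
      split_ifs with h
      · have : 1 ≤ (p : ℝ) ^ η := Real.one_le_rpow (by exact_mod_cast hpp.one_lt.le) hη.le
        exact hyp.trans (le_mul_of_one_le_right (by positivity) this)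
      · rw [one_mul]
        exact hyp.trans (hP p (not_lt.mp h))
    refine (Finset.prod_le_prod (fun _ _ => norm_nonneg _) h1).trans ?_
    rw [Finset.prod_mul_distrib]
    have h2 : ∏ p ∈ n.primeFactors, (p : ℝ) ^ η = (n : ℝ) ^ η := by
      rw [Real.finsetProd_rpow _ _ fun _ _ => Nat.cast_nonneg _, ← Nat.cast_prod,
        Nat.prod_primeFactors_of_squarefree hn]
    rw [h2]
    gcongr
    rw [← Finset.prod_filter, Finset.prod_const]
    refine pow_le_pow_right₀ hB1 ?_
    calc #{p ∈ n.primeFactors | p < P} ≤ #(range P) :=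
          Finset.card_le_card fun p hp => mem_range.mpr (mem_filter.mp hp).2
      _ = P := card_range P
  · rw [sqfreeProd_of_not_squarefree _ hn, norm_zero]
    positivity

/-- The constant is chosen before `y`, which later gives a bound uniform in `m` for the weights
`varianceWeight m`. -/
theorem exists_norm_sqfreeProd_le_of_div_sq (R : Type*) [NormedField R] [NormedAlgebra ℝ R] (A : ℝ)
    {η : ℝ} (hη : 0 < η) :
    ∃ C : ℝ, 0 ≤ C ∧ ∀ y : ℕ → R, (∀ p : ℕ, p.Prime → ‖y p‖ ≤ A / (p : ℝ) ^ 2) →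
      ∀ n : ℕ, ‖sqfreeProd y n‖ ≤ C * (n : ℝ) ^ (η - 2) := by
  obtain ⟨C, hC, h⟩ := exists_norm_sqfreeProd_le R A hη
  refine ⟨C, hC, fun y hy n => ?_⟩
  rcases Nat.eq_zero_or_pos n with rfl | hn
  · rw [sqfreeProd_zero, norm_zero]
    positivity
  have hnorm : ∀ k : ℕ, ‖(k : R)‖ = k := fun k => by
    rw [← map_natCast (algebraMap ℝ R), norm_algebraMap', Real.norm_natCast]
  have h1 := h (fun p => y p * (p : R) ^ 2) (fun p hp => by
    have hp0 : (0 : ℝ) < p := by exact_mod_cast hp.pos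
    rw [norm_mul, norm_pow, hnorm, ← le_div_iff₀ (by positivity)]
    exact hy p hp) n
  rw [sqfreeProd_mul_natCast_pow, norm_mul, norm_pow, hnorm] at h1
  have hnR : (0 : ℝ) < n := by exact_mod_cast hn
  rw [Real.rpow_sub hnR, Real.rpow_two, ← mul_div_assoc, le_div_iff₀ (by positivity)]
  exact h1

theorem summable_norm_sqfreeProd [NormedAlgebra ℝ R] {y : ℕ → R} {A : ℝ}
    (hy : ∀ p : ℕ, p.Prime → ‖y p‖ ≤ A / (p : ℝ) ^ 2) : Summable fun n => ‖sqfreeProd y n‖ := by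
  obtain ⟨C, _, h⟩ := exists_norm_sqfreeProd_le_of_div_sq R A (η := 1 / 2) (by norm_num)
  refine Summable.of_nonneg_of_le (fun _ => norm_nonneg _) (h y hy) (Summable.mul_left C ?_)
  exact Real.summable_nat_rpow.mpr (by norm_num)

theorem hasProd_one_add_sqfreeProd [CompleteSpace R] {y : ℕ → R}
    (hs : Summable fun n => ‖sqfreeProd y n‖) :
    HasProd (fun p : Nat.Primes => 1 + y p) (∑' n, sqfreeProd y n) := by
  have h := EulerProduct.eulerProduct_hasProd (sqfreeProd_one y) (sqfreeProd_mul y) hs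
    (sqfreeProd_zero y)
  have e : (fun p : Nat.Primes => 1 + y p) =
      fun p : Nat.Primes => ∑' k : ℕ, sqfreeProd y ((p : ℕ) ^ k) := by
    funext p
    rw [tsum_eq_sum (s := range 2) fun k hk => sqfreeProd_prime_pow y p.2
      (not_lt.mp fun h' => hk (mem_range.mpr h'))]
    rw [Finset.sum_range_succ, Finset.sum_range_one, pow_zero, pow_one, sqfreeProd_one,
      sqfreeProd_prime y p.2]
  rw [e]
  exact h

/-- The double series converges absolutely, so it may be sorted by the product of the two indices;
each fibre is then summed by `sqfreeProd_add`. Hence a sum over coprime pairs becomes the Euler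
product with factors `1 + y p + z p`. -/
theorem hasSum_coprime_sqfreeProd_mul [CompleteSpace R] {y z : ℕ → R}
    (hy : Summable fun n => ‖sqfreeProd y n‖) (hz : Summable fun n => ‖sqfreeProd z n‖) :
    HasSum (fun x : ℕ+ × ℕ+ => if (x.1 : ℕ).Coprime x.2 then
      sqfreeProd y x.1 * sqfreeProd z x.2 else 0) (∑' n, sqfreeProd (fun p => y p + z p) n) := by
  have hinj : Function.Injective ((↑) : ℕ+ → ℕ) := PNat.coe_injective
  have hy' : Summable fun a : ℕ+ => ‖sqfreeProd y a‖ := hy.comp_injective hinj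
  have hz' : Summable fun a : ℕ+ => ‖sqfreeProd z a‖ := hz.comp_injective hinj
  have hyz := Summable.mul_norm (f := fun a : ℕ+ => sqfreeProd y a)
    (g := fun a : ℕ+ => sqfreeProd z a) hy' hz'
  have hbound : ∀ x : ℕ+ × ℕ+, ‖(if (x.1 : ℕ).Coprime x.2 then
      sqfreeProd y x.1 * sqfreeProd z x.2 else 0)‖ ≤
      ‖sqfreeProd y x.1 * sqfreeProd z x.2‖ := fun x => by
    split_ifs
    · exact le_rfl
    · rw [norm_zero]
      exact norm_nonneg _
  have hsum := Summable.of_norm_bounded hyz hbound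
  obtain ⟨s, hs⟩ := hsum
  have hfib : ∀ n : ℕ+, HasSum (fun c : (n : ℕ).divisorsAntidiagonal =>
      if c.1.1.Coprime c.1.2 then sqfreeProd y c.1.1 * sqfreeProd z c.1.2 else 0)
      (sqfreeProd (fun p => y p + z p) n) := fun n => by
    rw [sqfreeProd_add, ← Finset.sum_coe_sort]
    exact hasSum_fintype _
  have hfst : ∀ c : (Σ n : ℕ+, (n : ℕ).divisorsAntidiagonal),
      ((sigmaAntidiagonalEquivProd c).1 : ℕ) = c.2.1.1 := fun _ => rfl
  have hsnd : ∀ c : (Σ n : ℕ+, (n : ℕ).divisorsAntidiagonal),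
      ((sigmaAntidiagonalEquivProd c).2 : ℕ) = c.2.1.2 := fun _ => rfl
  have h0 : HasSum (fun c : (Σ n : ℕ+, (n : ℕ).divisorsAntidiagonal) =>
      if c.2.1.1.Coprime c.2.1.2 then sqfreeProd y c.2.1.1 * sqfreeProd z c.2.1.2 else 0) s := by
    refine (sigmaAntidiagonalEquivProd.hasSum_iff.mpr hs).of_eq (fun c => ?_) rfl
    simp only [Function.comp_apply, hfst, hsnd]
  have h1 : HasSum (fun n : ℕ+ => sqfreeProd (fun p => y p + z p) n) s := h0.sigma hfib
  have h2 : HasSum (sqfreeProd fun p => y p + z p) s := by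
    refine (hinj.hasSum_iff fun n hn => ?_).mp h1
    have : n = 0 := by
      by_contra h0
      exact hn ⟨⟨n, Nat.pos_of_ne_zero h0⟩, rfl⟩
    rw [this, sqfreeProd_zero]
  rwa [h2.tsum_eq]

end Normed

/-! ### Sums over pairs: sorting by gcd, and tails -/

/-- The decomposition of a pair of positive integers into its gcd and a coprime pair. -/
noncomputable def gcdCoprimeEquiv :
    ℕ+ × {x : ℕ+ × ℕ+ | (x.1 : ℕ).Coprime x.2} ≃ ℕ+ × ℕ+ :=
  Equiv.ofBijective (fun c => (c.1 * c.2.1.1, c.1 * c.2.1.2)) <| by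
    constructor
    · rintro ⟨m, ⟨⟨a, b⟩, hab⟩⟩ ⟨m', ⟨⟨a', b'⟩, hab'⟩⟩ h
      simp only [Prod.mk.injEq] at h
      have h1 : (m : ℕ) * a = m' * a' := by exact_mod_cast congrArg PNat.val h.1
      have h2 : (m : ℕ) * b = m' * b' := by exact_mod_cast congrArg PNat.val h.2
      have hg : (m : ℕ) = m' := by
        have e1 : Nat.gcd ((m : ℕ) * a) (m * b) = m := by
          rw [Nat.gcd_mul_left, Nat.Coprime.gcd_eq_one hab, mul_one]
        have e2 : Nat.gcd ((m' : ℕ) * a') (m' * b') = m' := by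
          rw [Nat.gcd_mul_left, Nat.Coprime.gcd_eq_one hab', mul_one]
        rw [← e1, h1, h2, e2]
      have hm : m = m' := PNat.coe_injective hg
      subst hm
      have ha : a = a' := PNat.coe_injective (Nat.eq_of_mul_eq_mul_left m.pos h1)
      have hb : b = b' := PNat.coe_injective (Nat.eq_of_mul_eq_mul_left m.pos h2)
      subst ha hb
      rfl
    · rintro ⟨u, v⟩
      obtain ⟨g, a, b, hg, hab, hu, hv⟩ :=
        Nat.exists_coprime' (Nat.gcd_pos_of_pos_left (v : ℕ) u.pos)
      have ha : 0 < a := Nat.pos_of_mul_pos_right (hu ▸ u.pos)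
      have hb : 0 < b := Nat.pos_of_mul_pos_right (hv ▸ v.pos)
      refine ⟨(⟨g, hg⟩, ⟨(⟨a, ha⟩, ⟨b, hb⟩), hab⟩), ?_⟩
      refine Prod.ext (PNat.coe_injective ?_) (PNat.coe_injective ?_)
      · exact (mul_comm g a).trans hu.symm
      · exact (mul_comm g b).trans hv.symm

theorem gcdCoprimeEquiv_apply (c : ℕ+ × {x : ℕ+ × ℕ+ | (x.1 : ℕ).Coprime x.2}) :
    gcdCoprimeEquiv c = (c.1 * c.2.1.1, c.1 * c.2.1.2) := rfl

theorem hasSum_nat_prod_iff {R : Type*} [AddCommMonoid R] [TopologicalSpace R] {f : ℕ × ℕ → R}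
    {s : R} (h1 : ∀ n, f (0, n) = 0) (h2 : ∀ n, f (n, 0) = 0) :
    HasSum (fun x : ℕ+ × ℕ+ => f (x.1, x.2)) s ↔ HasSum f s := by
  have hinj : Function.Injective (fun x : ℕ+ × ℕ+ => ((x.1 : ℕ), (x.2 : ℕ))) := fun x y h => by
    simp only [Prod.mk.injEq, PNat.coe_inj] at h
    exact Prod.ext h.1 h.2
  refine hinj.hasSum_iff ?_
  rintro ⟨a, b⟩ hx
  rcases Nat.eq_zero_or_pos a with rfl | ha
  · exact h1 b
  rcases Nat.eq_zero_or_pos b with rfl | hb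
  · exact h2 a
  exact absurd ⟨(⟨a, ha⟩, ⟨b, hb⟩), rfl⟩ hx

/-- Trading `m^{2η}` for `n^{2η}` makes the exponent of `m` summable, and the exponent of `n` splits
as `3η - 2 = (4η - 1) + (-1 - η)`: a saving in `K` times a summable power. -/
theorem rpow_mul_min_le {m n : ℕ} (hm : 0 < m) (hmn : m ≤ n) {K η : ℝ} (hη : 0 < η)
    (hη' : η ≤ 1 / 4) (hK : 0 < K) (hKn : K ≤ n) :
    ((m : ℝ) * n) ^ (η - 2) * m ≤
      K ^ (4 * η - 1) * ((m : ℝ) ^ (-1 - η) * (n : ℝ) ^ (-1 - η)) := by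
  have hmR : (0 : ℝ) < m := by exact_mod_cast hm
  have hnR : (0 : ℝ) < n := by exact_mod_cast hm.trans_le hmn
  have hmnR : (m : ℝ) ≤ n := by exact_mod_cast hmn
  have h1 : (n : ℝ) ^ (4 * η - 1) ≤ K ^ (4 * η - 1) :=
    Real.rpow_le_rpow_of_nonpos hK hKn (by linarith)
  have h2 : (m : ℝ) ^ (2 * η) ≤ (n : ℝ) ^ (2 * η) := by gcongr
  calc ((m : ℝ) * n) ^ (η - 2) * m
      = (m : ℝ) ^ (-1 - η) * (n : ℝ) ^ (η - 2) * (m : ℝ) ^ (2 * η) := by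
        rw [Real.mul_rpow hmR.le hnR.le]
        have : (m : ℝ) ^ (η - 2) * m = (m : ℝ) ^ (-1 - η) * (m : ℝ) ^ (2 * η) := by
          rw [← Real.rpow_add hmR, ← Real.rpow_add_one hmR.ne']
          congr 1
          ring
        linear_combination (n : ℝ) ^ (η - 2) * this
    _ ≤ (m : ℝ) ^ (-1 - η) * (n : ℝ) ^ (η - 2) * (n : ℝ) ^ (2 * η) := by gcongr
    _ = (n : ℝ) ^ (4 * η - 1) * ((m : ℝ) ^ (-1 - η) * (n : ℝ) ^ (-1 - η)) := by
        have : (n : ℝ) ^ (η - 2) * (n : ℝ) ^ (2 * η) =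
            (n : ℝ) ^ (4 * η - 1) * (n : ℝ) ^ (-1 - η) := by
          rw [← Real.rpow_add hnR, ← Real.rpow_add hnR]
          congr 1
          ring
        linear_combination (m : ℝ) ^ (-1 - η) * this
    _ ≤ _ := by gcongr

/-- From `{t} - {t}² ≤ t`, the correlation is at most `H gcd(m,n)/(mn)`, and the gcd is at most the
smaller index. `K = 1` yields convergence, `K = M` the tail outside the box. -/
theorem norm_mul_fractCorr_le {a : ℕ → ℂ} {C η H K : ℝ} (hH : 0 ≤ H) (hη : 0 < η)
    (hη' : η ≤ 1 / 4) (hC : 0 ≤ C) (ha : ∀ n, 0 < n → ‖a n‖ ≤ C * (n : ℝ) ^ (η - 1)) (ha0 : a 0 = 0)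
    (hK : 0 < K) (m n : ℕ) (hKmn : K ≤ max (m : ℝ) n) :
    ‖a m * (starRingEnd ℂ) (a n) * (fractCorr H m n : ℂ)‖ ≤
      C ^ 2 * H * K ^ (4 * η - 1) * ((m : ℝ) ^ (-1 - η) * (n : ℝ) ^ (-1 - η)) := by
  rcases Nat.eq_zero_or_pos m with rfl | hm
  · rw [ha0, zero_mul, zero_mul, norm_zero]
    positivity
  rcases Nat.eq_zero_or_pos n with rfl | hn
  · rw [ha0, map_zero, mul_zero, zero_mul, norm_zero]
    positivity
  have hmR : (0 : ℝ) < m := by exact_mod_cast hm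
  have hnR : (0 : ℝ) < n := by exact_mod_cast hn
  have hg0 : 0 < m.gcd n := Nat.gcd_pos_of_pos_left _ hm
  have hgR : (0 : ℝ) < m.gcd n := by exact_mod_cast hg0
  have key : ((m : ℝ) * n) ^ (η - 2) * (m.gcd n) ≤
      K ^ (4 * η - 1) * ((m : ℝ) ^ (-1 - η) * (n : ℝ) ^ (-1 - η)) := by
    rcases le_total m n with h | h
    · have hmnR : (m : ℝ) ≤ n := by exact_mod_cast h
      refine le_trans ?_ (rpow_mul_min_le hm h hη hη' hK (by rwa [max_eq_right hmnR] at hKmn))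
      gcongr
      exact Nat.gcd_le_left n hm
    · have hmnR : (n : ℝ) ≤ m := by exact_mod_cast h
      rw [mul_comm ((m : ℝ) ^ (-1 - η)), mul_comm (m : ℝ)]
      refine le_trans ?_ (rpow_mul_min_le hn h hη hη' hK (by rwa [max_eq_left hmnR] at hKmn))
      gcongr
      exact Nat.gcd_le_right m hn
  have hcorr : fractCorr H m n ≤ H * (m.gcd n) / (m * n) := by
    calc fractCorr H m n ≤ (m.gcd n : ℝ) ^ 2 / (m * n) * (H / m.gcd n) := by
          unfold fractCorr
          gcongr
          exact fractVar_le_self (by positivity)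
      _ = H * (m.gcd n) / (m * n) := by field_simp
  rw [norm_mul, norm_mul, Complex.norm_conj, Complex.norm_real,
    Real.norm_of_nonneg (fractCorr_nonneg H m n)]
  calc ‖a m‖ * ‖a n‖ * fractCorr H m n
      ≤ (C * (m : ℝ) ^ (η - 1)) * (C * (n : ℝ) ^ (η - 1)) * (H * (m.gcd n) / (m * n)) := by
        gcongr
        · exact fractCorr_nonneg H m n
        · exact ha m hm
        · exact ha n hn
    _ = C ^ 2 * H * (((m : ℝ) * n) ^ (η - 2) * (m.gcd n)) := by
        have e : ((m : ℝ) * n) ^ (η - 2) = (m : ℝ) ^ (η - 1) * (n : ℝ) ^ (η - 1) / (m * n) := by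
          rw [← Real.mul_rpow hmR.le hnR.le, ← Real.rpow_sub_one (by positivity)]
          congr 1
          ring
        rw [e]
        ring
    _ ≤ C ^ 2 * H * (K ^ (4 * η - 1) * ((m : ℝ) ^ (-1 - η) * (n : ℝ) ^ (-1 - η))) := by gcongr
    _ = _ := by ring

theorem summable_rpow_mul_rpow {η : ℝ} (hη : 0 < η) :
    Summable fun x : ℕ × ℕ => (x.1 : ℝ) ^ (-1 - η) * (x.2 : ℝ) ^ (-1 - η) := by
  have h : Summable fun n : ℕ => (n : ℝ) ^ (-1 - η) :=
    Real.summable_nat_rpow.mpr (by linarith)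
  have h2 := Summable.mul_of_nonneg h h (fun n => by positivity) (fun n => by positivity)
  exact h2

theorem summable_mul_fractCorr {a : ℕ → ℂ} {C η H : ℝ} (hH : 0 ≤ H) (hη : 0 < η)
    (hη' : η ≤ 1 / 4) (hC : 0 ≤ C) (ha : ∀ n, 0 < n → ‖a n‖ ≤ C * (n : ℝ) ^ (η - 1))
    (ha0 : a 0 = 0) :
    Summable fun x : ℕ × ℕ => a x.1 * (starRingEnd ℂ) (a x.2) * (fractCorr H x.1 x.2 : ℂ) := by
  refine Summable.of_norm_bounded
    ((summable_rpow_mul_rpow hη).mul_left (C ^ 2 * H * (1 : ℝ) ^ (4 * η - 1))) fun x => ?_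
  obtain ⟨m, n⟩ := x
  rcases Nat.eq_zero_or_pos m with rfl | hm
  · rw [ha0, zero_mul, zero_mul, norm_zero]
    positivity
  · exact norm_mul_fractCorr_le hH hη hη' hC ha ha0 one_pos m n
      (le_max_of_le_left (by exact_mod_cast hm))

theorem norm_hasSum_sub_sum_le {a : ℕ → ℂ} {C η H : ℝ} (hH : 0 ≤ H) (hη : 0 < η)
    (hη' : η ≤ 1 / 4) (hC : 0 ≤ C) (ha : ∀ n, 0 < n → ‖a n‖ ≤ C * (n : ℝ) ^ (η - 1))
    (ha0 : a 0 = 0) {s : ℂ} (hs : HasSum (fun x : ℕ × ℕ =>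
      a x.1 * (starRingEnd ℂ) (a x.2) * (fractCorr H x.1 x.2 : ℂ)) s) {M : ℕ} (hM : 0 < M) :
    ‖s - ∑ x ∈ Icc 1 M ×ˢ Icc 1 M,
      a x.1 * (starRingEnd ℂ) (a x.2) * (fractCorr H x.1 x.2 : ℂ)‖ ≤
    C ^ 2 * H * (M : ℝ) ^ (4 * η - 1) *
      ∑' x : ℕ × ℕ, (x.1 : ℝ) ^ (-1 - η) * (x.2 : ℝ) ^ (-1 - η) := by
  set T : ℕ × ℕ → ℂ := fun x => a x.1 * (starRingEnd ℂ) (a x.2) * (fractCorr H x.1 x.2 : ℂ) with hT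
  set S := Icc 1 M ×ˢ Icc 1 M with hS
  have h1 : HasSum (fun x => if x ∈ S then T x else 0) (∑ x ∈ S, T x) := by
    have h : HasSum (fun x => if x ∈ S then T x else 0) (∑ x ∈ S, if x ∈ S then T x else 0) :=
      hasSum_sum_of_ne_finset_zero fun x hx => if_neg hx
    rwa [Finset.sum_congr rfl fun x hx => if_pos hx] at h
  refine (hs.sub h1).norm_le_of_bounded ((summable_rpow_mul_rpow hη).hasSum.mul_left _) fun x => ?_
  split_ifs with hx
  · rw [sub_self, norm_zero]
    positivity
  · rw [sub_zero]
    obtain ⟨m, n⟩ := x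
    rcases Nat.eq_zero_or_pos m with rfl | hm
    · simp only [hT]
      rw [ha0, zero_mul, zero_mul, norm_zero]
      positivity
    rcases Nat.eq_zero_or_pos n with rfl | hn
    · simp only [hT]
      rw [ha0, map_zero, mul_zero, zero_mul, norm_zero]
      positivity
    refine norm_mul_fractCorr_le hH hη hη' hC ha ha0 (by exact_mod_cast hM) m n ?_
    rw [hS, mem_product, mem_Icc, mem_Icc] at hx
    by_contra! hlt
    rw [max_lt_iff] at hlt
    have e1 : m < M := by exact_mod_cast hlt.1
    have e2 : n < M := by exact_mod_cast hlt.2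
    exact hx ⟨⟨hm, e1.le⟩, ⟨hn, e2.le⟩⟩

/-! ### The coefficients `μ g` and the series `c_F(H)` -/

namespace PolynomialEulerProduct

variable {d : ℕ} (F : PolynomialEulerProduct d)

/-- The value at `p` of the multiplicative function `μ g`. -/
noncomputable def localCoeff (p : ℕ) : ℂ := -((p : ℂ) * (1 - (F.eulerFactor p 1)⁻¹))

/-- The multiplicative function `μ g`. -/
noncomputable def coeff (n : ℕ) : ℂ := sqfreeProd F.localCoeff n

/-- `F_p(1)⁻¹ = ∏ (1 - α_j(p)/p)` differs from `1` by at most `e^{d/p} - 1 ≤ (d/p) e^d`. -/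
theorem norm_localCoeff_le {p : ℕ} (hp : p.Prime) : ‖F.localCoeff p‖ ≤ d * Real.exp d := by
  have hp0 : (0 : ℝ) < p := by exact_mod_cast hp.pos
  have hp1 : (1 : ℝ) ≤ p := by exact_mod_cast hp.one_lt.le
  have h1 : (F.eulerFactor p 1)⁻¹ = ∏ j : Fin d, (1 + -(F.α j p / p)) := by
    rw [eulerFactor, ← Finset.prod_inv_distrib]
    refine Finset.prod_congr rfl fun j _ => ?_
    rw [inv_inv, Complex.cpow_neg_one]
    ring
  have h2 := Finset.norm_prod_one_add_sub_one_le univ fun j : Fin d => -(F.α j p / (p : ℂ))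
  have h3 : ∑ j : Fin d, ‖-(F.α j p / (p : ℂ))‖ ≤ d / p := by
    calc _ ≤ ∑ _j : Fin d, 1 / (p : ℝ) := by
          refine Finset.sum_le_sum fun j _ => ?_
          rw [norm_neg, norm_div, Complex.norm_natCast]
          gcongr
          exact F.norm_α_le_one j p hp
      _ = d / p := by simp [div_eq_mul_inv]
  have h4 : Real.exp (d / p : ℝ) - 1 ≤ d / p * Real.exp d := by
    have h5 := Real.add_one_le_exp (-(d / p : ℝ))
    have h6 : Real.exp (d / p : ℝ) ≤ Real.exp d := by
      gcongr
      exact div_le_self (Nat.cast_nonneg d) hp1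
    have h7 : Real.exp (d / p : ℝ) * Real.exp (-(d / p : ℝ)) = 1 := by
      rw [← Real.exp_add]; simp
    have h8 : 0 < Real.exp (d / p : ℝ) := Real.exp_pos _
    have h9 : Real.exp (d / p : ℝ) - 1 ≤ d / p * Real.exp (d / p : ℝ) := by nlinarith
    exact h9.trans (by gcongr)
  rw [localCoeff, norm_neg, norm_mul, Complex.norm_natCast, norm_sub_rev, h1]
  calc (p : ℝ) * ‖∏ j : Fin d, (1 + -(F.α j p / (p : ℂ))) - 1‖
      ≤ p * (d / p * Real.exp d) := by
        gcongr
        refine h2.trans (le_trans ?_ h4)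
        gcongr
    _ = d * Real.exp d := by field_simp

theorem inv_eulerFactor {p : ℕ} (hp : p.Prime) :
    (F.eulerFactor p 1)⁻¹ = 1 + F.localCoeff p / p := by
  have : (p : ℂ) ≠ 0 := by exact_mod_cast hp.ne_zero
  rw [localCoeff]
  field_simp
  ring

theorem coeff_zero : F.coeff 0 = 0 := sqfreeProd_zero _

theorem sqfreeProd_localCoeff_div_pow (k n : ℕ) :
    sqfreeProd (fun p => F.localCoeff p / (p : ℂ) ^ k) n = F.coeff n / (n : ℂ) ^ k := by
  rcases Nat.eq_zero_or_pos n with rfl | hn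
  · rw [sqfreeProd_zero, coeff_zero, zero_div]
  have hn' : (n : ℂ) ≠ 0 := by exact_mod_cast hn.ne'
  rw [eq_div_iff (pow_ne_zero _ hn'), ← sqfreeProd_mul_natCast_pow]
  refine sqfreeProd_congr fun p hp => ?_
  have : (p : ℂ) ≠ 0 := by exact_mod_cast (Nat.prime_of_mem_primeFactors hp).ne_zero
  exact div_mul_cancel₀ _ (pow_ne_zero _ this)

theorem totient_div_eq_sum {n : ℕ} (hn : n ≠ 0) :
    F.totient n / n = ∑ e ∈ n.divisors, F.coeff e / e := by
  have hn' : (n : ℂ) ≠ 0 := by exact_mod_cast hn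
  rw [totient, mul_div_cancel_left₀ _ hn']
  have h := prod_primeFactors_one_add (fun p => F.localCoeff p / (p : ℂ) ^ 1) hn
  simp only [sqfreeProd_localCoeff_div_pow] at h
  simp only [pow_one] at h
  rw [← h]
  exact Finset.prod_congr rfl fun p hp => F.inv_eulerFactor (Nat.prime_of_mem_primeFactors hp)

theorem norm_localCoeff_div_sq_le {p : ℕ} (hp : p.Prime) :
    ‖F.localCoeff p / (p : ℂ) ^ 2‖ ≤ d * Real.exp d / (p : ℝ) ^ 2 := by
  rw [norm_div, norm_pow, Complex.norm_natCast]
  gcongr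
  exact F.norm_localCoeff_le hp

theorem hasProd_meanFactor : HasProd F.meanFactor (∑' n : ℕ, F.coeff n / (n : ℂ) ^ 2) := by
  have h := hasProd_one_add_sqfreeProd
    (summable_norm_sqfreeProd fun p hp => F.norm_localCoeff_div_sq_le hp)
  simp only [sqfreeProd_localCoeff_div_pow] at h
  convert h using 2 with p
  have : ((p : ℕ) : ℂ) ≠ 0 := by exact_mod_cast p.2.ne_zero
  rw [meanFactor, inv_eulerFactor F p.2]
  field_simp
  ring

theorem two_mul_C : 2 * F.C = ∑' n : ℕ, F.coeff n / (n : ℂ) ^ 2 := by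
  rw [C, F.hasProd_meanFactor.tprod_eq]
  ring

/-- The deviation from `1` of the factors in the singular series of the variance. -/
noncomputable def varianceWeight (m p : ℕ) : ℝ :=
  if p ∣ m then 0 else 2 * (F.localCoeff p / (p : ℂ) ^ 2).re

theorem varianceFactor_eq (m : ℕ) (p : Nat.Primes) :
    F.varianceFactor m p = 1 + F.varianceWeight m p := by
  rw [varianceFactor, varianceWeight]
  split_ifs
  · simp
  · have hp : ((p : ℕ) : ℝ) ≠ 0 := by exact_mod_cast p.2.ne_zero
    have h : F.localCoeff p / ((p : ℕ) : ℂ) ^ 2 =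
        ((-1 / ((p : ℕ) : ℝ) : ℝ) : ℂ) * (1 - (F.eulerFactor p 1)⁻¹) := by
      have hp' : ((p : ℕ) : ℂ) ≠ 0 := by exact_mod_cast p.2.ne_zero
      rw [localCoeff]
      push_cast
      field_simp
    rw [h, Complex.re_ofReal_mul]
    ring

theorem norm_varianceWeight_le (m : ℕ) {p : ℕ} (hp : p.Prime) :
    ‖F.varianceWeight m p‖ ≤ 2 * (d * Real.exp d) / (p : ℝ) ^ 2 := by
  rw [varianceWeight]
  split_ifs
  · rw [norm_zero]
    positivity
  · rw [norm_mul, Real.norm_two, mul_div_assoc]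
    gcongr
    exact (Complex.abs_re_le_norm _).trans (F.norm_localCoeff_div_sq_le hp)

theorem hasProd_varianceFactor (m : ℕ) :
    HasProd (F.varianceFactor m) (∑' n : ℕ, sqfreeProd (F.varianceWeight m) n) := by
  have h := hasProd_one_add_sqfreeProd
    (summable_norm_sqfreeProd fun p hp => F.norm_varianceWeight_le m hp)
  rw [show F.varianceFactor m = fun p : Nat.Primes => 1 + F.varianceWeight m p from
    funext (F.varianceFactor_eq m)]
  exact h

theorem moebius_sq_mul_norm_g_sq (m : ℕ) :
    (ArithmeticFunction.moebius m : ℝ) ^ 2 * ‖F.g m‖ ^ 2 = ‖F.coeff m‖ ^ 2 := by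
  by_cases hm : Squarefree m
  · have h1 : (ArithmeticFunction.moebius m : ℝ) ^ 2 = 1 := by
      exact_mod_cast ArithmeticFunction.moebius_sq_eq_one_of_squarefree hm
    rw [h1, one_mul, g, coeff, sqfreeProd_of_squarefree _ hm, norm_prod, norm_prod]
    congr 1
    exact Finset.prod_congr rfl fun p _ => by rw [localCoeff, norm_neg]
  · rw [ArithmeticFunction.moebius_eq_zero_of_not_squarefree hm, coeff,
      sqfreeProd_of_not_squarefree _ hm]
    simp

theorem varianceTerm_eq (H : ℝ) (m : ℕ) :
    F.varianceTerm H m = ‖F.coeff m‖ ^ 2 / (m : ℝ) ^ 2 *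
      (∑' n : ℕ, sqfreeProd (F.varianceWeight m) n) * fractVar (H / m) := by
  rw [varianceTerm, moebius_sq_mul_norm_g_sq, (F.hasProd_varianceFactor m).tprod_eq, fractVar]

theorem exists_norm_coeff_le {η : ℝ} (hη : 0 < η) :
    ∃ C : ℝ, 0 ≤ C ∧ ∀ n : ℕ, ‖F.coeff n‖ ≤ C * (n : ℝ) ^ η := by
  obtain ⟨C, hC, h⟩ := exists_norm_sqfreeProd_le ℂ (d * Real.exp d) hη
  exact ⟨C, hC, h F.localCoeff fun p hp => F.norm_localCoeff_le hp⟩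

theorem summable_varianceTerm (H : ℝ) : Summable fun m : ℕ+ => F.varianceTerm H m := by
  obtain ⟨C, hC, h⟩ := F.exists_norm_coeff_le (η := 1 / 4) (by norm_num)
  obtain ⟨D, hD, hD'⟩ := exists_norm_sqfreeProd_le_of_div_sq ℝ (2 * (d * Real.exp d))
    (η := 1 / 2) (by norm_num)
  have hs : Summable fun n : ℕ => (n : ℝ) ^ ((1 / 2 : ℝ) - 2) :=
    Real.summable_nat_rpow.mpr (by norm_num)
  have hs' : Summable fun m : ℕ+ => ((m : ℕ) : ℝ) ^ ((1 / 2 : ℝ) - 2) :=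
    hs.comp_injective PNat.coe_injective
  refine Summable.of_norm_bounded (hs'.mul_left (C ^ 2 * ∑' n : ℕ, D * (n : ℝ) ^ ((1 / 2 : ℝ) - 2)))
    fun m => ?_
  have hm : (0 : ℝ) < (m : ℕ) := by exact_mod_cast m.pos
  have h1 : ‖∑' n : ℕ, sqfreeProd (F.varianceWeight m) n‖ ≤
      ∑' n : ℕ, D * (n : ℝ) ^ ((1 / 2 : ℝ) - 2) :=
    tsum_of_norm_bounded (hs.mul_left D).hasSum
      (hD' _ fun p hp => F.norm_varianceWeight_le m hp)
  have h2 : ‖F.coeff m‖ ^ 2 / ((m : ℕ) : ℝ) ^ 2 ≤ C ^ 2 * ((m : ℕ) : ℝ) ^ ((1 / 2 : ℝ) - 2) := by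
    rw [Real.rpow_sub hm, Real.rpow_two, ← mul_div_assoc]
    gcongr
    calc ‖F.coeff m‖ ^ 2 ≤ (C * ((m : ℕ) : ℝ) ^ (1 / 4 : ℝ)) ^ 2 := by
          gcongr
          exact h m
      _ = C ^ 2 * ((m : ℕ) : ℝ) ^ (1 / 2 : ℝ) := by
          rw [mul_pow, ← Real.rpow_natCast (((m : ℕ) : ℝ) ^ (1 / 4 : ℝ)), ← Real.rpow_mul hm.le]
          norm_num
  have h3 : ‖fractVar (H / (m : ℕ))‖ ≤ 1 := by
    rw [Real.norm_of_nonneg (fractVar_nonneg _)]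
    exact fractVar_le_one _
  rw [varianceTerm_eq, norm_mul, norm_mul, Real.norm_of_nonneg (by positivity :
    0 ≤ ‖F.coeff m‖ ^ 2 / ((m : ℕ) : ℝ) ^ 2)]
  calc _ ≤ (C ^ 2 * ((m : ℕ) : ℝ) ^ ((1 / 2 : ℝ) - 2)) *
        (∑' n : ℕ, D * (n : ℝ) ^ ((1 / 2 : ℝ) - 2)) * 1 := by gcongr
    _ = _ := by ring

theorem coeff_mul_div_sq (m : ℕ) {n : ℕ} (hn : n ≠ 0) :
    F.coeff (m * n) / (n : ℂ) ^ 2 = F.coeff m *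
      sqfreeProd (fun p => if p ∣ m then 0 else F.localCoeff p / (p : ℂ) ^ 2) n := by
  rw [sqfreeProd_ite_dvd _ hn, sqfreeProd_localCoeff_div_pow]
  split_ifs with h
  · rw [coeff, sqfreeProd_mul _ h]
    simp only [coeff]
    ring
  · rw [coeff, sqfreeProd_mul_of_not_coprime _ h]
    simp

/-- For a pair `(mn, mk)` with `n`, `k` coprime, the correlation is `fractVar(H/m)/(nk)`, while
`μg(mn)` vanishes unless `m` and `n` are coprime and then factors. What remains is a sum over
coprime pairs with local values `y p` and their conjugates, and `y p + z p = 2 Re (y p)` is the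
weight of the Euler product in the `m`-th term. -/
theorem hasSum_coprime_coeff_mul (H : ℝ) (m : ℕ+) :
    HasSum (fun c : {x : ℕ+ × ℕ+ | (x.1 : ℕ).Coprime x.2} =>
      F.coeff (m * c.1.1 : ℕ) / (m * c.1.1 : ℕ) *
        (starRingEnd ℂ) (F.coeff (m * c.1.2 : ℕ) / (m * c.1.2 : ℕ)) *
        (fractCorr H (m * c.1.1 : ℕ) (m * c.1.2 : ℕ) : ℂ)) (F.varianceTerm H m : ℂ) := by
  set y : ℕ → ℂ := fun p => if p ∣ (m : ℕ) then 0 else F.localCoeff p / (p : ℂ) ^ 2 with hy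
  set z : ℕ → ℂ := fun p => (starRingEnd ℂ) (y p) with hz
  have hyb : ∀ p : ℕ, p.Prime → ‖y p‖ ≤ d * Real.exp d / (p : ℝ) ^ 2 := fun p hp => by
    simp only [hy]
    split_ifs
    · rw [norm_zero]
      positivity
    · exact F.norm_localCoeff_div_sq_le hp
  have hzb : ∀ p : ℕ, p.Prime → ‖z p‖ ≤ d * Real.exp d / (p : ℝ) ^ 2 := fun p hp => by
    simp only [hz]
    rw [Complex.norm_conj]
    exact hyb p hp
  have h1 := hasSum_coprime_sqfreeProd_mul (summable_norm_sqfreeProd hyb)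
    (summable_norm_sqfreeProd hzb)
  have hyz : (fun p => y p + z p) = fun p => (algebraMap ℝ ℂ) (F.varianceWeight m p) := by
    funext p
    simp only [hz, hy, varianceWeight]
    rw [Complex.add_conj]
    split_ifs <;> simp
  have h2 : ∑' n, sqfreeProd (fun p => y p + z p) n =
      ((∑' n : ℕ, sqfreeProd (F.varianceWeight m) n : ℝ) : ℂ) := by
    rw [hyz, Complex.ofReal_tsum]
    exact tsum_congr fun n => (map_sqfreeProd (algebraMap ℝ ℂ) _ n).symm
  rw [h2] at h1
  have h3 := h1.mul_left ((‖F.coeff m‖ ^ 2 / ((m : ℕ) : ℝ) ^ 2 * fractVar (H / (m : ℕ)) : ℝ) : ℂ)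
  have hval : ((‖F.coeff m‖ ^ 2 / ((m : ℕ) : ℝ) ^ 2 * fractVar (H / (m : ℕ)) : ℝ) : ℂ) *
      ((∑' n : ℕ, sqfreeProd (F.varianceWeight m) n : ℝ) : ℂ) = (F.varianceTerm H m : ℂ) := by
    rw [varianceTerm_eq, ← Complex.ofReal_mul]
    congr 1
    ring
  rw [hval] at h3
  have h4 : HasSum ({x : ℕ+ × ℕ+ | (x.1 : ℕ).Coprime x.2}.indicator fun x : ℕ+ × ℕ+ =>
      ((‖F.coeff m‖ ^ 2 / ((m : ℕ) : ℝ) ^ 2 * fractVar (H / (m : ℕ)) : ℝ) : ℂ) *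
      (sqfreeProd y x.1 * sqfreeProd z x.2)) (F.varianceTerm H m : ℂ) := by
    refine h3.of_eq (fun x => ?_) rfl
    simp only [Set.indicator_apply, Set.mem_ofPred_eq, mul_ite, mul_zero]
  refine (hasSum_subtype_iff_indicator.mpr h4).of_eq ?_ rfl
  rintro ⟨⟨n, k⟩, hnk⟩
  have hnk' : (n : ℕ).Coprime k := hnk
  have hm0 : ((m : ℕ) : ℂ) ≠ 0 := by exact_mod_cast m.ne_zero
  have hn0 : ((n : ℕ) : ℂ) ≠ 0 := by exact_mod_cast n.ne_zero
  have hk0 : ((k : ℕ) : ℂ) ≠ 0 := by exact_mod_cast k.ne_zero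
  have e1 : F.coeff ((m : ℕ) * n) = F.coeff m * sqfreeProd y n * ((n : ℕ) : ℂ) ^ 2 := by
    rw [← F.coeff_mul_div_sq m n.ne_zero]
    field_simp
  have e2 : (starRingEnd ℂ) (F.coeff ((m : ℕ) * k)) =
      (starRingEnd ℂ) (F.coeff m) * sqfreeProd z k * ((k : ℕ) : ℂ) ^ 2 := by
    have e3 : F.coeff ((m : ℕ) * k) = F.coeff m * sqfreeProd y k * ((k : ℕ) : ℂ) ^ 2 := by
      rw [← F.coeff_mul_div_sq m k.ne_zero]
      field_simp
    rw [e3, map_mul, map_mul, map_sqfreeProd, map_pow, Complex.conj_natCast]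
  have e4 : F.coeff m * (starRingEnd ℂ) (F.coeff m) = ((‖F.coeff m‖ : ℝ) : ℂ) ^ 2 :=
    Complex.mul_conj' _
  have e5 : fractCorr H ((m : ℕ) * n) ((m : ℕ) * k) =
      1 / ((n : ℕ) * (k : ℕ) : ℝ) * fractVar (H / (m : ℕ)) := by
    rw [fractCorr, Nat.gcd_mul_left, hnk'.gcd_eq_one, mul_one]
    have hm0' : ((m : ℕ) : ℝ) ≠ 0 := by exact_mod_cast m.ne_zero
    push_cast
    field_simp
  simp only [Function.comp_apply]
  rw [map_div₀, e2, e1, e5, Complex.conj_natCast]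
  push_cast
  rw [← e4]
  field_simp

/-- Absolute convergence permits grouping the pairs by their gcd `m`; uniqueness of the sum
identifies the total. -/
theorem hasSum_coeff_mul_fractCorr {H : ℝ} (hH : 0 ≤ H) :
    HasSum (fun x : ℕ × ℕ => F.coeff x.1 / x.1 * (starRingEnd ℂ) (F.coeff x.2 / x.2) *
      (fractCorr H x.1 x.2 : ℂ)) (F.varianceConstant H : ℂ) := by
  obtain ⟨C, hC, h⟩ := F.exists_norm_coeff_le (η := 1 / 4) (by norm_num)
  have ha : ∀ n : ℕ, 0 < n → ‖F.coeff n / n‖ ≤ C * (n : ℝ) ^ ((1 / 4 : ℝ) - 1) := fun n hn => by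
    have hnR : (0 : ℝ) < n := by exact_mod_cast hn
    rw [norm_div, Complex.norm_natCast, Real.rpow_sub_one hnR.ne', ← mul_div_assoc]
    gcongr
    exact h n
  have hsum := summable_mul_fractCorr (a := fun n => F.coeff n / n) hH (by norm_num) le_rfl hC ha
    (by simp)
  obtain ⟨s, hs⟩ := hsum
  have hs' := (hasSum_nat_prod_iff (fun n => by simp) (fun n => by simp)).mpr hs
  have h1 := gcdCoprimeEquiv.hasSum_iff.mpr hs'
  have h2 : HasSum (fun m : ℕ+ => (F.varianceTerm H m : ℂ)) s := by
    refine h1.prod_fiberwise fun m => ?_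
    refine (F.hasSum_coprime_coeff_mul H m).of_eq (fun c => ?_) rfl
    simp only [Function.comp_apply, gcdCoprimeEquiv_apply, PNat.mul_coe]
  have h3 : HasSum (fun m : ℕ+ => (F.varianceTerm H m : ℂ)) (F.varianceConstant H : ℂ) :=
    Complex.hasSum_ofReal.mpr (F.summable_varianceTerm H).hasSum
  rwa [h2.unique h3] at hs

end PolynomialEulerProduct

/-! ### Finite expansion of the deviation -/

theorem sum_Ioc_sum_divisors_eq (a : ℕ → ℂ) {N M : ℕ} (hNM : N ≤ M) :
    ∑ n ∈ Ioc 0 N, ∑ e ∈ n.divisors, a e = ∑ e ∈ Icc 1 M, a e * ((N / e : ℕ) : ℂ) := by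
  have h1 : ∀ n ∈ Ioc 0 N, ∑ e ∈ n.divisors, a e =
      ∑ e ∈ Icc 1 M, if e ∣ n then a e else 0 := by
    intro n hn
    rw [mem_Ioc] at hn
    rw [← Finset.sum_filter]
    congr 1
    ext e
    simp only [Nat.mem_divisors, mem_filter, mem_Icc]
    constructor
    · rintro ⟨h, -⟩
      exact ⟨⟨Nat.pos_of_dvd_of_pos h hn.1, (Nat.le_of_dvd hn.1 h).trans (hn.2.trans hNM)⟩, h⟩
    · rintro ⟨-, h⟩
      exact ⟨h, hn.1.ne'⟩
  rw [Finset.sum_congr rfl h1, Finset.sum_comm]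
  refine Finset.sum_congr rfl fun e _ => ?_
  rw [← Finset.sum_filter, Finset.sum_const, Nat.Ioc_filter_dvd_card_eq_div, nsmul_eq_mul, mul_comm]

theorem intervalIntegrable_of_measurable_of_le {f : ℝ → ℝ} {K : ℝ} (hf : Measurable f)
    (hK : ∀ x, |f x| ≤ K) (a b : ℝ) : IntervalIntegrable f volume a b := by
  refine (intervalIntegrable_const (c := K)).mono_fun hf.aestronglyMeasurable
    (Eventually.of_forall fun x => ?_)
  exact (hK x).trans (le_abs_self K)

theorem norm_sum_fractDiff_le (a : ℕ → ℂ) (M : ℕ) (H x : ℝ) :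
    ‖∑ n ∈ Icc 1 M, a n * (fractDiff n H x : ℂ)‖ ≤ ∑ n ∈ Icc 1 M, ‖a n‖ := by
  refine (norm_sum_le _ _).trans (Finset.sum_le_sum fun n _ => ?_)
  rw [norm_mul, Complex.norm_real]
  exact mul_le_of_le_one_right (norm_nonneg _) (abs_fractDiff_le_one n H x)

theorem intervalIntegrable_norm_sum_fractDiff_add_sq (a : ℕ → ℂ) (M : ℕ) (H : ℝ) (c : ℂ)
    (u v : ℝ) : IntervalIntegrable
      (fun x => ‖∑ n ∈ Icc 1 M, a n * (fractDiff n H x : ℂ) + c‖ ^ 2) volume u v := by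
  have hm : ∀ n : ℕ, Measurable fun x => ((fractDiff n H x : ℝ) : ℂ) := fun n =>
    Complex.measurable_ofReal.comp (measurable_fractDiff n H)
  refine intervalIntegrable_of_measurable_of_le (K := (∑ n ∈ Icc 1 M, ‖a n‖ + ‖c‖) ^ 2) ?_ ?_ u v
  · exact (((Finset.measurable_fun_sum _ fun n _ => (hm n).const_mul (a n)).add_const c).norm).pow_const 2
  · intro x
    rw [abs_of_nonneg (by positivity)]
    gcongr
    exact (norm_add_le _ _).trans (by gcongr; exact norm_sum_fractDiff_le a M H x)

/-- Pointwise, `||S + c|² - |S|²| ≤ 2|S||c| + |c|²`. -/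
theorem abs_integral_norm_add_sq_sub_le {a : ℕ → ℂ} {M : ℕ} {H X A τ : ℝ} {c : ℂ} (hX : 0 ≤ X)
    (hA : ∑ n ∈ Icc 1 M, ‖a n‖ ≤ A) (hc : ‖c‖ ≤ τ) :
    |(∫ x in X..(2 * X), ‖∑ n ∈ Icc 1 M, a n * (fractDiff n H x : ℂ) + c‖ ^ 2) -
      ∫ x in X..(2 * X), ‖∑ n ∈ Icc 1 M, a n * (fractDiff n H x : ℂ)‖ ^ 2| ≤
    (2 * A * τ + τ ^ 2) * X := by
  have h1 := intervalIntegrable_norm_sum_fractDiff_add_sq a M H c X (2 * X)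
  have h2 := intervalIntegrable_norm_sum_fractDiff_add_sq a M H 0 X (2 * X)
  simp only [add_zero] at h2
  rw [← intervalIntegral.integral_sub h1 h2]
  have h3 := intervalIntegral.norm_integral_le_of_norm_le_const (a := X) (b := 2 * X)
    (C := 2 * A * τ + τ ^ 2) (f := fun x => ‖∑ n ∈ Icc 1 M, a n * (fractDiff n H x : ℂ) + c‖ ^ 2 -
      ‖∑ n ∈ Icc 1 M, a n * (fractDiff n H x : ℂ)‖ ^ 2) fun x _ => by
    set S := ∑ n ∈ Icc 1 M, a n * (fractDiff n H x : ℂ) with hS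
    have hSA : ‖S‖ ≤ A := (norm_sum_fractDiff_le a M H x).trans hA
    have h4 : ‖S + c‖ ≤ ‖S‖ + ‖c‖ := norm_add_le _ _
    have h5 : ‖S‖ ≤ ‖S + c‖ + ‖c‖ := by
      simpa using norm_sub_le (S + c) c
    have hS0 := norm_nonneg S
    have hc0 := norm_nonneg c
    have hSc0 := norm_nonneg (S + c)
    have h6 : ‖S‖ * ‖c‖ ≤ A * τ := mul_le_mul hSA hc hc0 (hS0.trans hSA)
    have h7 : ‖c‖ ^ 2 ≤ τ ^ 2 := by gcongr
    rw [Real.norm_eq_abs, abs_le]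
    constructor <;> nlinarith
  rwa [show 2 * X - X = X by ring, abs_of_nonneg hX] at h3

namespace PolynomialEulerProduct

variable {d : ℕ} (F : PolynomialEulerProduct d)

/-- The tail of the series for `2 C(F)`. -/
noncomputable def meanTail (M : ℕ) : ℂ :=
  2 * F.C - ∑ n ∈ Icc 1 M, F.coeff n / (n : ℂ) ^ 2

/-- Divisors beyond `x + H` contribute nothing, so a single cutoff `M` serves all `x` in the
interval; the parts `H/n` of the counts rebuild `2 C(F) H` except for the tail. -/
theorem deviation_eq {H x : ℝ} (hH : 0 ≤ H) (hx : 0 ≤ x) {M : ℕ} (hM : ⌊x + H⌋₊ ≤ M) :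
    F.deviation H x = -(∑ n ∈ Icc 1 M, F.coeff n / n * (fractDiff n H x : ℂ) +
      H * F.meanTail M) := by
  have hle : ⌊x⌋₊ ≤ ⌊x + H⌋₊ := Nat.floor_mono (by linarith)
  have h1 : ∀ N ≤ M, ∑ n ∈ Ioc 0 N, F.totient n / (n : ℂ) =
      ∑ e ∈ Icc 1 M, F.coeff e / e * ((N / e : ℕ) : ℂ) := fun N hN => by
    rw [← sum_Ioc_sum_divisors_eq _ hN]
    exact Finset.sum_congr rfl fun n hn => F.totient_div_eq_sum (mem_Ioc.mp hn).1.ne'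
  have h2 := Finset.sum_Ioc_consecutive (fun n : ℕ => F.totient n / (n : ℂ)) (Nat.zero_le _) hle
  rw [h1 _ (hle.trans hM), h1 _ hM] at h2
  rw [deviation, eq_sub_iff_add_eq'.mpr h2, meanTail, ← Finset.sum_sub_distrib, mul_sub,
    Finset.mul_sum]
  have h3 : ∀ n ∈ Icc 1 M, F.coeff n / n * ((⌊x + H⌋₊ / n : ℕ) : ℂ) -
      F.coeff n / n * ((⌊x⌋₊ / n : ℕ) : ℂ) =
      H * (F.coeff n / (n : ℂ) ^ 2) - F.coeff n / n * (fractDiff n H x : ℂ) := by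
    intro n hn
    have hn0 : 0 < n := (mem_Icc.mp hn).1
    have hnC : (n : ℂ) ≠ 0 := by exact_mod_cast hn0.ne'
    rw [fractDiff_eq (by exact_mod_cast hn0) hH hx, Nat.floor_div_natCast, Nat.floor_div_natCast]
    push_cast
    field_simp
    ring
  rw [Finset.sum_congr rfl h3, Finset.sum_sub_distrib]
  ring

theorem norm_deviation_sq_eq {H x : ℝ} (hH : 0 ≤ H) (hx : 0 ≤ x) {M : ℕ} (hM : ⌊x + H⌋₊ ≤ M) :
    ‖F.deviation H x‖ ^ 2 = ‖∑ n ∈ Icc 1 M, F.coeff n / n * (fractDiff n H x : ℂ) +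
      H * F.meanTail M‖ ^ 2 := by
  rw [F.deviation_eq hH hx hM, norm_neg]

theorem intervalIntegrable_norm_deviation_sq {X H : ℝ} (hX : 0 ≤ X) (hH : 0 ≤ H) :
    IntervalIntegrable (fun x => ‖F.deviation H x‖ ^ 2) volume X (2 * X) := by
  refine (intervalIntegrable_norm_sum_fractDiff_add_sq (fun n => F.coeff n / n) ⌊2 * X + H⌋₊ H
    (H * F.meanTail ⌊2 * X + H⌋₊) X (2 * X)).congr fun x hx => ?_
  rw [Set.uIoc_of_le (by linarith)] at hx
  exact (F.norm_deviation_sq_eq hH (hX.trans hx.1.le)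
    (Nat.floor_mono (by linarith [hx.2]))).symm

theorem norm_meanTail_le {C η : ℝ} (hη : 0 < η) (hη' : η ≤ 1 / 2) (hC : 0 ≤ C)
    (h : ∀ n : ℕ, ‖F.coeff n‖ ≤ C * (n : ℝ) ^ η) {M : ℕ} (hM : 0 < M) :
    ‖F.meanTail M‖ ≤ C * (M : ℝ) ^ (2 * η - 1) * ∑' n : ℕ, (n : ℝ) ^ (-1 - η) := by
  have hMR : (0 : ℝ) < M := by exact_mod_cast hM
  have hs : Summable fun n : ℕ => F.coeff n / (n : ℂ) ^ 2 := by
    have := (summable_norm_sqfreeProd fun p hp => F.norm_localCoeff_div_sq_le hp).of_norm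
    exact this.congr fun n => F.sqfreeProd_localCoeff_div_pow 2 n
  have h1 : HasSum (fun n : ℕ => if n ∈ Icc 1 M then F.coeff n / (n : ℂ) ^ 2 else 0)
      (∑ n ∈ Icc 1 M, F.coeff n / (n : ℂ) ^ 2) := by
    have h : HasSum (fun n : ℕ => if n ∈ Icc 1 M then F.coeff n / (n : ℂ) ^ 2 else 0)
      (∑ n ∈ Icc 1 M, if n ∈ Icc 1 M then F.coeff n / (n : ℂ) ^ 2 else 0) :=
      hasSum_sum_of_ne_finset_zero fun x hx => if_neg hx
    rwa [Finset.sum_congr rfl fun x hx => if_pos hx] at h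
  have hr : Summable fun n : ℕ => (n : ℝ) ^ (-1 - η) := Real.summable_nat_rpow.mpr (by linarith)
  rw [meanTail, two_mul_C]
  refine (hs.hasSum.sub h1).norm_le_of_bounded (hr.hasSum.mul_left _) fun n => ?_
  split_ifs with hn
  · rw [sub_self, norm_zero]
    positivity
  rw [sub_zero]
  rcases Nat.eq_zero_or_pos n with rfl | hn0
  · rw [coeff_zero, zero_div, norm_zero]
    positivity
  have hMn : (M : ℝ) ≤ n := by
    rw [mem_Icc] at hn
    have : M ≤ n := by omega
    exact_mod_cast this
  have hnR : (0 : ℝ) < n := by exact_mod_cast hn0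
  rw [norm_div, norm_pow, Complex.norm_natCast, div_le_iff₀ (by positivity)]
  calc ‖F.coeff n‖ ≤ C * (n : ℝ) ^ η := h n
    _ = C * (n : ℝ) ^ (2 * η - 1) * (n : ℝ) ^ (-1 - η) * (n : ℝ) ^ 2 := by
        rw [mul_assoc, mul_assoc, ← Real.rpow_add_natCast hnR.ne', ← Real.rpow_add hnR]
        congr 2
        push_cast
        ring
    _ ≤ _ := by
        gcongr C * ?_ * _ * _
        exact Real.rpow_le_rpow_of_nonpos hMR hMn (by linarith)

/-! ### Collecting the errors -/

theorem one_add_log_le {η : ℝ} (hη : 0 < η) {M : ℕ} (hM : 0 < M) :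
    1 + Real.log M ≤ (1 + 1 / η) * (M : ℝ) ^ η := by
  have h1 := Real.log_le_rpow_div (Nat.cast_nonneg M) hη
  have h2 : 1 ≤ (M : ℝ) ^ η := Real.one_le_rpow (by exact_mod_cast hM) hη.le
  calc _ ≤ (M : ℝ) ^ η + (M : ℝ) ^ η / η := add_le_add h2 h1
    _ = _ := by ring

theorem sum_norm_coeff_div_le {C η : ℝ} (hη : 0 < η) (hC : 0 ≤ C)
    (h : ∀ n : ℕ, ‖F.coeff n‖ ≤ C * (n : ℝ) ^ η) {M : ℕ} (hM : 0 < M) :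
    ∑ n ∈ Icc 1 M, ‖F.coeff n / n‖ ≤ C * (1 + 1 / η) * (M : ℝ) ^ (2 * η) := by
  have hMR : (0 : ℝ) < M := by exact_mod_cast hM
  have h1 : ∀ n ∈ Icc 1 M, ‖F.coeff n / n‖ ≤ C * (M : ℝ) ^ η * (1 / n) := fun n hn => by
    have hnM : (n : ℝ) ≤ M := by exact_mod_cast (mem_Icc.mp hn).2
    rw [norm_div, Complex.norm_natCast, mul_one_div]
    gcongr
    exact (h n).trans (by gcongr)
  refine (Finset.sum_le_sum h1).trans ?_
  rw [← Finset.mul_sum]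
  calc _ ≤ C * (M : ℝ) ^ η * ((1 + 1 / η) * (M : ℝ) ^ η) := by
        gcongr
        exact (sum_Icc_one_div_le M).trans (one_add_log_le hη hM)
    _ = _ := by
        rw [show 2 * η = η + η by ring, Real.rpow_add hMR]
        ring

/-- With `q = M^η`, the correlations cost `q² · q³` (coefficients and three logarithms), while the
tail of the mean value and the completion of the double sum cost `q⁴`. This is the exponent `5η -
1`. -/
theorem exists_abs_variance_sub_le {η : ℝ} (hη : 0 < η) (hη' : η ≤ 1 / 5) :
    ∃ K : ℝ, 0 ≤ K ∧ ∀ X H : ℝ, 1 ≤ X → 0 ≤ H → H ≤ X →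
      |F.variance X H - F.varianceConstant H| ≤ K * (H * X ^ (5 * η - 1)) := by
  obtain ⟨C, hC, h⟩ := F.exists_norm_coeff_le hη
  set l : ℝ := 1 + 1 / η with hl
  set s : ℝ := ∑' n : ℕ, (n : ℝ) ^ (-1 - η) with hs
  set s2 : ℝ := ∑' x : ℕ × ℕ, (x.1 : ℝ) ^ (-1 - η) * (x.2 : ℝ) ^ (-1 - η) with hs2
  have hl0 : 0 ≤ l := by positivity
  have hs0 : 0 ≤ s := tsum_nonneg fun n => by positivity
  have hs20 : 0 ≤ s2 := tsum_nonneg fun x => by positivity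
  refine ⟨96 * (C ^ 2 * l ^ 3) + 2 * (C * l) * (C * s) + (C * s) ^ 2 + C ^ 2 * s2, by positivity,
    fun X H hX hH hHX => ?_⟩
  have hX0 : 0 < X := one_pos.trans_le hX
  -- For `x ≤ 2X` and `H ≤ X`, the endpoint `x + H` is at most `3X`; also `M ≤ 4X` since `X ≥ 1`.
  set M := ⌈3 * X⌉₊ with hMdef
  have hM3 : 3 * X ≤ M := Nat.le_ceil _
  have hM4 : (M : ℝ) ≤ 4 * X := by
    have := Nat.ceil_lt_add_one (a := 3 * X) (by positivity)
    linarith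
  have hMR : (0 : ℝ) < M := by linarith
  have hM : 0 < M := by exact_mod_cast hMR
  have hM1 : (1 : ℝ) ≤ M := by exact_mod_cast hM
  have hXM : X ≤ M := by linarith
  have hHM : H ≤ M := hHX.trans hXM
  set a : ℕ → ℂ := fun n => F.coeff n / n with ha
  set c : ℂ := H * F.meanTail M with hc
  set q : ℝ := (M : ℝ) ^ η with hq
  have hq1 : 1 ≤ q := Real.one_le_rpow hM1 hη.le
  have hpow : ∀ k : ℕ, (M : ℝ) ^ (k * η - 1) = q ^ k / M := fun k => by
    rw [Real.rpow_sub_one hMR.ne', hq, ← Real.rpow_natCast, ← Real.rpow_mul hMR.le, mul_comm η]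
  set τ : ℝ := H * (C * s) * (q ^ 2 / M) with hτ
  have hcτ : ‖c‖ ≤ τ := by
    have h2 := F.norm_meanTail_le hη (by linarith) hC h hM
    have e := hpow 2
    push_cast at e
    rw [e] at h2
    rw [hc, norm_mul, Complex.norm_real, Real.norm_of_nonneg hH, hτ, mul_assoc]
    gcongr
    exact h2.trans (le_of_eq (by ring))
  have hA : ∑ n ∈ Icc 1 M, ‖a n‖ ≤ C * l * q ^ 2 := by
    refine (F.sum_norm_coeff_div_le hη hC h hM).trans (le_of_eq ?_)
    rw [hq, ← Real.rpow_natCast, ← Real.rpow_mul hMR.le]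
    push_cast
    rw [mul_comm η 2]
  have hvar : ∫ x in X..(2 * X), ‖F.deviation H x‖ ^ 2 =
      ∫ x in X..(2 * X), ‖∑ n ∈ Icc 1 M, a n * (fractDiff n H x : ℂ) + c‖ ^ 2 := by
    refine intervalIntegral.integral_congr fun x hx => ?_
    rw [Set.uIcc_of_le (by linarith)] at hx
    refine F.norm_deviation_sq_eq hH (hX0.le.trans hx.1) ?_
    have : ⌊x + H⌋₊ ≤ ⌊(M : ℝ)⌋₊ := Nat.floor_mono (by linarith [hx.2])
    rwa [Nat.floor_natCast] at this
  have e1 := abs_integral_norm_add_sq_sub_le (H := H) hX0.le hA hcτ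
  have e2 := abs_integral_norm_sum_sq_sub_le (a := a) (B := C * q) (M := M) hX0.le hH fun n hn => by
    have hnM : (n : ℝ) ≤ M := by exact_mod_cast (mem_Icc.mp hn).2
    simp only [ha]
    rw [norm_div, Complex.norm_natCast, hq]
    gcongr
    exact (h n).trans (by gcongr)
  have ha' : ∀ n : ℕ, 0 < n → ‖a n‖ ≤ C * (n : ℝ) ^ (η - 1) := fun n hn => by
    have hnR : (0 : ℝ) < n := by exact_mod_cast hn
    simp only [ha]
    rw [norm_div, Complex.norm_natCast, Real.rpow_sub_one hnR.ne', ← mul_div_assoc]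
    gcongr
    exact h n
  have e3 := norm_hasSum_sub_sum_le hH hη (by linarith) hC ha' (by simp [ha])
    (F.hasSum_coeff_mul_fractCorr hH) hM
  set D : ℝ := ∑ m ∈ Icc 1 M, ∑ n ∈ Icc 1 M, (a m * (starRingEnd ℂ) (a n)).re * fractCorr H m n
    with hD
  have e4 : |F.varianceConstant H - D| ≤ C ^ 2 * H * (q ^ 4 / M) * s2 := by
    have e := hpow 4
    push_cast at e
    rw [e] at e3
    refine le_trans (le_of_eq ?_) ((Complex.abs_re_le_norm _).trans e3)
    rw [Complex.sub_re, Complex.ofReal_re, Complex.re_sum, Finset.sum_product, hD]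
    congr 2
    exact Finset.sum_congr rfl fun m _ => Finset.sum_congr rfl fun n _ =>
      (Complex.re_mul_ofReal _ _).symm
  have hL0 : 0 ≤ 1 + Real.log M := by
    have := Real.log_nonneg hM1
    linarith
  have e5 : 24 * (C * q) ^ 2 * H * (1 + Real.log M) ^ 3 ≤ 24 * (C ^ 2 * l ^ 3) * (H * q ^ 5) := by
    calc _ ≤ 24 * (C * q) ^ 2 * H * (l * q) ^ 3 := by
          gcongr
          exact one_add_log_le hη hM
      _ = _ := by ring
  have hXM' : 1 / X ≤ 4 / M := by
    rw [div_le_div_iff₀ hX0 hMR]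
    linarith
  have e6 : |F.variance X H - D| ≤
      (2 * (C * l * q ^ 2) * τ + τ ^ 2) + 4 / M * (24 * (C ^ 2 * l ^ 3) * (H * q ^ 5)) := by
    have : F.variance X H - D = 1 / X * ((∫ x in X..(2 * X), ‖F.deviation H x‖ ^ 2) - X * D) := by
      rw [variance]
      field_simp
    rw [this, abs_mul, abs_of_pos (by positivity), hvar]
    calc _ ≤ 1 / X * ((2 * (C * l * q ^ 2) * τ + τ ^ 2) * X +
          24 * (C ^ 2 * l ^ 3) * (H * q ^ 5)) := by
          gcongr
          have e2' := e2.trans e5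
          rw [abs_le] at e1 e2' ⊢
          constructor <;> linarith [e1.1, e1.2, e2'.1, e2'.2]
      _ = (2 * (C * l * q ^ 2) * τ + τ ^ 2) + 1 / X * (24 * (C ^ 2 * l ^ 3) * (H * q ^ 5)) := by
          field_simp
      _ ≤ _ := by gcongr
  have hq45 : q ^ 4 ≤ q ^ 5 := pow_le_pow_right₀ hq1 (by norm_num)
  have e7 : 2 * (C * l * q ^ 2) * τ ≤ 2 * (C * l) * (C * s) * (H * (q ^ 5 / M)) := by
    calc _ = 2 * (C * l) * (C * s) * (H * (q ^ 4 / M)) := by rw [hτ]; ring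
      _ ≤ _ := by gcongr
  have e8 : τ ^ 2 ≤ (C * s) ^ 2 * (H * (q ^ 5 / M)) := by
    -- One of the two factors `H` is absorbed by `H ≤ M`.
    calc τ ^ 2 = (C * s) ^ 2 * (H * (q ^ 4 / M)) * (H / M) := by
          rw [hτ]
          field_simp
      _ ≤ (C * s) ^ 2 * (H * (q ^ 4 / M)) * 1 := by
          gcongr
          rwa [div_le_one hMR]
      _ ≤ _ := by
          rw [mul_one]
          gcongr
  have e9 : C ^ 2 * H * (q ^ 4 / M) * s2 ≤ C ^ 2 * s2 * (H * (q ^ 5 / M)) := by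
    calc _ = C ^ 2 * s2 * (H * (q ^ 4 / M)) := by ring
      _ ≤ _ := by gcongr
  have e10 : 4 / M * (24 * (C ^ 2 * l ^ 3) * (H * q ^ 5)) =
      96 * (C ^ 2 * l ^ 3) * (H * (q ^ 5 / M)) := by ring
  have e11 : q ^ 5 / M ≤ X ^ (5 * η - 1) := by
    have e := hpow 5
    push_cast at e
    rw [← e]
    exact Real.rpow_le_rpow_of_nonpos hX0 hXM (by linarith)
  calc |F.variance X H - F.varianceConstant H|
      ≤ (96 * (C ^ 2 * l ^ 3) + 2 * (C * l) * (C * s) + (C * s) ^ 2 + C ^ 2 * s2) *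
        (H * (q ^ 5 / M)) := by
        rw [abs_le] at e6 e4 ⊢
        constructor <;> linarith [e6.1, e6.2, e4.1, e4.2]
    _ ≤ _ := by gcongr

end PolynomialEulerProduct

theorem corollary1p6 {d : ℕ} (hd : 1 ≤ d) (F : PolynomialEulerProduct d) :
    -- the products and the series in the statement converge, and the integrals exist
    (Multipliable F.meanFactor ∧
      (∀ m : ℕ+, Multipliable (F.varianceFactor m)) ∧
      (∀ H : ℝ, Summable (fun m : ℕ+ => F.varianceTerm H m)) ∧
      (∀ X H : ℝ, 1 ≤ X → 0 ≤ H →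
        IntervalIntegrable (fun x => ‖F.deviation H x‖ ^ 2) MeasureTheory.volume X (2 * X))) ∧
    -- the asymptotic formula for the variance
    ∀ ε : ℝ, 0 < ε → ∃ K : ℝ, ∀ X H : ℝ, 1 ≤ X → 2 ≤ H → H ≤ X ^ (1 - ε) →
      |F.variance X H - F.varianceConstant H| ≤ K * H ^ (-ε) := by
  refine ⟨⟨F.hasProd_meanFactor.multipliable, fun m => (F.hasProd_varianceFactor m).multipliable,
    F.summable_varianceTerm, fun X H hX hH =>
      F.intervalIntegrable_norm_deviation_sq (zero_le_one.trans hX) hH⟩, fun ε hε => ?_⟩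
  rcases le_or_gt 1 ε with hε1 | hε1
  -- For `ε ≥ 1` the range is empty, as `H ≤ X^{1-ε} ≤ 1` contradicts `H ≥ 2`.
  · refine ⟨0, fun X H hX hH hHX => ?_⟩
    have : X ^ (1 - ε) ≤ 1 := Real.rpow_le_one_of_one_le_of_nonpos hX (by linarith)
    linarith
  -- This choice gives `1 - 5η = (1 - ε)(1 + ε)`, so raising `H ≤ X^{1-ε}` to the power `1 + ε`
  -- yields exactly `H X^{5η-1} ≤ H^{-ε}`.
  obtain ⟨K, hK, h⟩ := F.exists_abs_variance_sub_le (η := ε ^ 2 / 5) (by positivity) (by nlinarith)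
  refine ⟨K, fun X H hX hH hHX => ?_⟩
  have hX0 : 0 < X := one_pos.trans_le hX
  have hH0 : 0 < H := by linarith
  have hHX' : H ≤ X := hHX.trans ((Real.rpow_le_rpow_of_exponent_le hX (by linarith)).trans
    (Real.rpow_one X).le)
  refine (h X H hX hH0.le hHX').trans ?_
  gcongr
  have h1 : H ^ (1 + ε) ≤ X ^ (1 - ε ^ 2) := by
    calc H ^ (1 + ε) ≤ (X ^ (1 - ε)) ^ (1 + ε) := by gcongr
      _ = X ^ (1 - ε ^ 2) := by
          rw [← Real.rpow_mul hX0.le]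
          congr 1
          ring
  have h2 : H * X ^ (5 * (ε ^ 2 / 5) - 1) = H ^ (1 + ε) * H ^ (-ε) / X ^ (1 - ε ^ 2) := by
    rw [← Real.rpow_add hH0, show 1 + ε + -ε = 1 by ring, Real.rpow_one,
      show 5 * (ε ^ 2 / 5) - 1 = -(1 - ε ^ 2) by ring, Real.rpow_neg hX0.le, div_eq_mul_inv]
  rw [h2, div_le_iff₀ (by positivity), mul_comm]
  gcongr
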